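/- Let $d\ge 2$. For $1\le j\le d$ let $C_j$ be the hyperbolic geodesic of the unit disk $\mathbb D$ joining $e^{\pi i(j-1)/d}$ to $e^{\pi i j/d}$, let $C_{-j}$ be its complex conjugate, and let $g_j$ be the Möbius automorphism of $\mathbb D$ given by reflection in $C_j$ followed by complex conjugation. Let $\Gamma_0=G_d=\langle g_1,\dots,g_d\rangle$ (a Fuchsian group uniformizing a $(d+1)$-times punctured sphere), acting on the unit circle $\mathbb S^1$, and let $R$ be the ideal polygon with vertices at the $2d$-th roots of unity and edges $C_{\pm 1},\dots,C_{\pm d}$, a fundamental domain of $G_d$ with side pairings $g_j^{\pm1}:C_{\pm j}\to C_{\mp j}$. The Bowen-Series map of an ideal polygon with side pairings is the map $\mathbb S^1\to\mathbb S^1$ that acts, on the half-open counter-clockwise arc $[P,P')$ subtended by each edge (with $P,P'$ consecutive vertices), as the pairing transformation of that edge. Let $A$ be the Bowen-Series map of $R$, and for $\gamma\in\Gamma_0$ let $A^\gamma$ be that of the fundamental domain $\gamma\cdot R$, whose edges are $\gamma(C_{\pm j})$ and whose side pairings are $\gamma g_j^{\pm1}\gamma^{-1}$. A measure of maximal entropy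 (MME) of a map is an invariant Borel probability measure whose measure-theoretic entropy equals the topological entropy of the map. The Hausdorff dimension of a Borel probability measure $\mu$ on $\mathbb S^1$ is $\mathrm{HD}(\mu)=\inf\{\mathrm{HD}(Y): Y\subset\mathbb S^1 \text{ Borel},\ \mu(Y)=1\}$. Then: 1. $A$ has a unique measure of maximal entropy $\nu$, and for every $\gamma\in\Gamma_0$ the measures $\nu$ and $\gamma_*\nu$ are mutually absolutely continuous. 2. For every $\gamma\in\Gamma_0$, the map $A^\gamma$ has a unique measure of maximal entropy. The measures of maximal entropy of the maps $A^\gamma$, $\gamma\in\Gamma_0$, are pairwise mutually absolutely continuous, and they all have the same Hausdorff dimension. -/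

import Mathlib

open MeasureTheory Filter Topology Real

noncomputable section

/-! ### Entropy, measures of maximal entropy, Hausdorff dimension of a measure -/

/-- The Shannon entropy `H_μ(ξ) = - ∑ i, μ(ξ = i) log μ(ξ = i)` of the finite partition of `X`
into the fibres of a labelling map `ξ : X → ι`. -/
def partitionEntropy {X ι : Type*} [MeasurableSpace X] [Fintype ι]
    (μ : Measure X) (ξ : X → ι) : ℝ :=
  ∑ i, Real.negMulLog (μ.real (ξ ⁻¹' {i}))

/-- The labelling of the join `ξ ∨ T⁻¹ ξ ∨ ⋯ ∨ T⁻⁽ⁿ⁻¹⁾ ξ`: the `ξ`-itinerary of length `n`. -/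
def itinerary {X ι : Type*} (T : X → X) (ξ : X → ι) (n : ℕ) : X → (Fin n → ι) :=
  fun x i => ξ (T^[i] x)

/-- The entropy `h_μ(T, ξ) = lim (1/n) H_μ(ξ ∨ T⁻¹ ξ ∨ ⋯ ∨ T⁻⁽ⁿ⁻¹⁾ ξ)` of `T` relative to a finite
partition `ξ` (the limit exists when `T` preserves `μ`, and is written as an upper limit). -/
def entropyOfPartition {X ι : Type*} [MeasurableSpace X] [Fintype ι]
    (T : X → X) (μ : Measure X) (ξ : X → ι) : EReal :=
  limsup (fun n : ℕ => ((partitionEntropy μ (itinerary T ξ n) / n : ℝ) : EReal)) atTop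

/-- The measure-theoretic (Kolmogorov-Sinai) entropy `h_μ(T)`: the supremum of `h_μ(T, ξ)` over
all finite measurable partitions `ξ`. -/
def measureEntropy {X : Type*} [MeasurableSpace X] (T : X → X) (μ : Measure X) : EReal :=
  ⨆ (k : ℕ) (ξ : X → Fin k) (_ : Measurable ξ), entropyOfPartition T μ ξ

/-- `μ` is a measure of maximal entropy for `T`: a `T`-invariant Borel probability measure whose
measure-theoretic entropy is equal to the topological entropy of `T`. -/
structure IsMME {X : Type*} [UniformSpace X] [MeasurableSpace X]
    (T : X → X) (μ : Measure X) : Prop where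
  isProbabilityMeasure : IsProbabilityMeasure μ
  measurePreserving : MeasurePreserving T μ μ
  entropy_eq : measureEntropy T μ = Dynamics.coverEntropy T Set.univ

/-- The Hausdorff dimension of a probability measure:
`HD(μ) = inf {HD(Y) : Y Borel, μ(Y) = 1}`. -/
def measureHausdorffDim {X : Type*} [EMetricSpace X] [MeasurableSpace X]
    (μ : Measure X) : ENNReal :=
  ⨅ (Y : Set X) (_ : MeasurableSet Y) (_ : μ Y = 1), dimH Y

/-- The Borel sigma-algebra of the unit circle. -/
instance Circle.instMeasurableSpaceBorel : MeasurableSpace Circle := borel Circle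

instance Circle.instBorelSpaceBorel : BorelSpace Circle := ⟨rfl⟩

/-! ### Hyperbolic reflections acting on the unit circle -/

/-- Inversion in a circle with centre `c` and radius `r` that is orthogonal to the unit circle
(that is, `‖c‖ ^ 2 = 1 + r ^ 2`) preserves the unit circle. -/
theorem norm_inversion_of_orthogonal {c : ℂ} {r : ℝ} (h : ‖c‖ ^ 2 = 1 + r ^ 2) {z : ℂ}
    (hz : ‖z‖ = 1) : ‖EuclideanGeometry.inversion c r z‖ = 1 := by
  by_cases hzc : z = c
  · subst hzc
    simpa using hz
  · have hD : ‖z - c‖ ^ 2 ≠ 0 := by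
      have : ‖z - c‖ ≠ 0 := norm_ne_zero_iff.mpr (sub_ne_zero.mpr hzc)
      positivity
    have hsq : ‖EuclideanGeometry.inversion c r z‖ ^ 2 = 1 := by
      have hz2 : ‖z‖ ^ 2 = 1 := by rw [hz]; norm_num
      have key : EuclideanGeometry.inversion c r z
          = ((r ^ 2 / ‖z - c‖ ^ 2 : ℝ) : ℂ) * (z - c) + c := by
        simp [EuclideanGeometry.inversion, dist_eq_norm, div_pow]
      rw [key]
      generalize hD' : ‖z - c‖ ^ 2 = D at hD
      rw [← Complex.normSq_eq_norm_sq, Complex.normSq_apply] at h hz2 hD' ⊢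
      simp only [Complex.sub_re, Complex.sub_im, Complex.add_re, Complex.add_im,
        Complex.mul_re, Complex.mul_im, Complex.ofReal_re, Complex.ofReal_im] at hD' ⊢
      field_simp
      linear_combination (D - r ^ 2) * D * h + r ^ 2 * D * hz2 + (r ^ 4 - r ^ 2 * D) * hD'
    have h0 : 0 ≤ ‖EuclideanGeometry.inversion c r z‖ := norm_nonneg _
    nlinarith

theorem continuous_inversion_circle {c : ℂ} {r : ℝ} (hr : r ≠ 0) (h : ‖c‖ ^ 2 = 1 + r ^ 2) :
    Continuous fun z : Circle => (⟨EuclideanGeometry.inversion c r z,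
      mem_sphere_zero_iff_norm.2 (norm_inversion_of_orthogonal h z.norm_coe)⟩ : Circle) := by
  refine Continuous.subtype_mk ?_ _
  refine Continuous.inversion continuous_const continuous_const continuous_subtype_val ?_
  rintro z rfl
  rw [Circle.norm_coe] at h
  apply hr
  nlinarith [sq_nonneg r]

/-- The action on the unit circle of the reflection in the hyperbolic geodesic of the unit disk
cut out by the Euclidean circle with centre `c` and radius `r` orthogonal to the unit circle. -/
def hypReflection (c : ℂ) (r : ℝ) (hr : r ≠ 0) (h : ‖c‖ ^ 2 = 1 + r ^ 2) : Circle ≃ₜ Circle where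
  toFun z := ⟨EuclideanGeometry.inversion c r z,
    mem_sphere_zero_iff_norm.2 (norm_inversion_of_orthogonal h z.norm_coe)⟩
  invFun z := ⟨EuclideanGeometry.inversion c r z,
    mem_sphere_zero_iff_norm.2 (norm_inversion_of_orthogonal h z.norm_coe)⟩
  left_inv z := Circle.ext (EuclideanGeometry.inversion_inversion c hr z)
  right_inv z := Circle.ext (EuclideanGeometry.inversion_inversion c hr z)
  continuous_toFun := continuous_inversion_circle hr h
  continuous_invFun := continuous_inversion_circle hr h

/-- The centre of the Euclidean circle through `exp (π i j / d)` and `exp (π i (j + 1) / d)` that is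
orthogonal to the unit circle. -/
def sideCenter (d : ℕ) (j : Fin d) : ℂ :=
  ((Real.cos (π / (2 * d)))⁻¹ : ℝ) * (Circle.exp (π * (2 * (j : ℕ) + 1) / (2 * d)) : ℂ)

/-- The radius of the Euclidean circle through `exp (π i j / d)` and `exp (π i (j + 1) / d)` that is
orthogonal to the unit circle. -/
def sideRadius (d : ℕ) : ℝ := Real.tan (π / (2 * d))

theorem sideAngle_mem {d : ℕ} (hd : 2 ≤ d) : 0 < π / (2 * d) ∧ π / (2 * d) < π / 2 := by
  have h2 : (2 : ℝ) ≤ d := by exact_mod_cast hd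
  refine ⟨by positivity, ?_⟩
  apply div_lt_div_of_pos_left Real.pi_pos (by norm_num)
  linarith

theorem sideRadius_ne_zero {d : ℕ} (hd : 2 ≤ d) : sideRadius d ≠ 0 :=
  (Real.tan_pos_of_pos_of_lt_pi_div_two (sideAngle_mem hd).1 (sideAngle_mem hd).2).ne'

theorem norm_sideCenter_sq {d : ℕ} (hd : 2 ≤ d) (j : Fin d) :
    ‖sideCenter d j‖ ^ 2 = 1 + sideRadius d ^ 2 := by
  have hc : 0 < Real.cos (π / (2 * d)) :=
    Real.cos_pos_of_mem_Ioo ⟨by linarith [(sideAngle_mem hd).1, Real.pi_pos], (sideAngle_mem hd).2⟩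
  rw [sideCenter, sideRadius, norm_mul, Circle.norm_coe, mul_one, Complex.norm_real,
    Real.norm_eq_abs, sq_abs, Real.tan_eq_sin_div_cos]
  field_simp
  linarith [Real.sin_sq_add_cos_sq (π / (2 * d))]

/-! ### The punctured sphere group and its Bowen-Series maps -/

/-- The generator `g_{j+1}` (for `j = 0, …, d - 1`), as a map of the unit circle: reflection in the
hyperbolic geodesic joining `exp (π i j / d)` and `exp (π i (j + 1) / d)`, followed by complex
conjugation (which is `z ↦ z⁻¹` on the unit circle). -/
def sideGenerator {d : ℕ} (hd : 2 ≤ d) (j : Fin d) : Circle ≃ₜ Circle :=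
  (hypReflection (sideCenter d j) (sideRadius d) (sideRadius_ne_zero hd)
    (norm_sideCenter_sq hd j)).trans (Homeomorph.inv Circle)

/-- The Fuchsian group `G_d` generated by `g_1, …, g_d`, uniformizing a `(d + 1)`-times punctured
sphere, in its action on the unit circle (a Möbius automorphism of the unit disk is determined by
its action on the unit circle). -/
def puncturedSphereGroup {d : ℕ} (hd : 2 ≤ d) : Subgroup (Circle ≃ₜ Circle) :=
  Subgroup.closure (Set.range (sideGenerator hd))

/-- The half-open arc `[a, b)` of the unit circle, traversed counter-clockwise from `a` to `b`. -/
def ccwArc (a b : Circle) : Set Circle :=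
  {z | ∃ s t : ℝ, 0 ≤ s ∧ s < t ∧ t < 2 * π ∧ b = Circle.exp t * a ∧ z = Circle.exp s * a}

/-- An ideal polygon in the unit disk decorated with side-pairing transformations: side `i` is the
geodesic from `vertex i` to the cyclically next vertex (vertices listed counter-clockwise), and
`pairing i` is the transformation (in its action on the circle) that carries it to another side. -/
structure MarkedIdealPolygon (n : ℕ) where
  vertex : Fin n → Circle
  pairing : Fin n → (Circle ≃ₜ Circle)

/-- The translate `γ · R`: its sides are the images of the sides of `R` under `γ`, and its side
pairings are the conjugates by `γ` of the side pairings of `R`. -/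
def MarkedIdealPolygon.translate {n : ℕ} (R : MarkedIdealPolygon n) (γ : Circle ≃ₜ Circle) :
    MarkedIdealPolygon n where
  vertex i := γ (R.vertex i)
  pairing i := γ * R.pairing i * γ⁻¹

open Classical in
/-- The Bowen-Series map of a marked ideal polygon: it acts as the pairing of the `i`-th side on
the counter-clockwise arc `[vertex i, vertex (i + 1))` that the side subtends. -/
def MarkedIdealPolygon.bowenSeriesMap {n : ℕ} (R : MarkedIdealPolygon n) : Circle → Circle :=
  fun z =>
    if h : ∃ i, z ∈ ccwArc (R.vertex i) (R.vertex (finRotate n i)) then R.pairing h.choose z else z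

/-- The preferred fundamental domain `R` of `G_d`: the ideal polygon with vertices at the `2d`-th
roots of unity `exp (π i k / d)`, `k = 0, …, 2d - 1`. The side starting at `exp (π i k / d)` with
`k < d` is paired by `g_{k+1}`; its mirror image in the real axis, which starts at
`exp (π i (2d - 1 - k) / d)`, is paired by `g_{k+1}⁻¹`. -/
def preferredDomain {d : ℕ} (hd : 2 ≤ d) : MarkedIdealPolygon (2 * d) where
  vertex k := Circle.exp (π * (k : ℕ) / d)
  pairing k :=
    if h : (k : ℕ) < d then sideGenerator hd ⟨k, h⟩
    else (sideGenerator hd ⟨2 * d - 1 - k, by omega⟩)⁻¹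

end

/-!
Multiplication by `N` on `ℝ / ℤ` has the base `N` digits as a generator, so by Kolmogorov–Sinai
every invariant measure has entropy at most `log N`. Equality forces the first `n` digits to be
uniformly distributed for every `n`, and so Lebesgue measure is the only measure of maximal entropy.

The side pairing of each edge of `R` is a reflection in the edge followed by complex conjugation.
The pieces glue at the vertices, so `A` lifts to a continuous, strictly increasing and expanding
map of the line of degree `2d - 1`. Such a circle map is conjugate to multiplication by `2d - 1`,
and the image `ν` of Lebesgue measure is the only measure of maximal entropy of `A`.

At every point a side pairing `p` either agrees with `A` or is undone by `A`. The conjugacy shows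
that `A` sends `ν`-null sets to `ν`-null sets, so `p` preserves the measure class of `ν`, and so
does the whole group. Each `γ` in the group preserves counter-clockwise arcs, hence conjugates `A`
to `A^γ`, whose measure of maximal entropy is therefore `γ_* ν`. Finally `γ` is bi-Lipschitz, which
gives the equality of dimensions.
-/

section NegMulLog

theorem mul_negMulLog_div {x y : ℝ} (h : y = 0 → x = 0) :
    y * negMulLog (x / y) = negMulLog x + x * log y := by
  rcases eq_or_ne x 0 with rfl | hx
  · simp
  · have hy : y ≠ 0 := mt h hx
    rw [negMulLog, negMulLog, Real.log_div hx hy]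
    field_simp
    ring

theorem sum_mul_negMulLog_div_le {κ : Type*} {s : Finset κ} {x y : κ → ℝ}
    (hx : ∀ k ∈ s, 0 ≤ x k) (hxy : ∀ k ∈ s, x k ≤ y k) :
    ∑ k ∈ s, y k * negMulLog (x k / y k) ≤
      (∑ k ∈ s, y k) * negMulLog ((∑ k ∈ s, x k) / ∑ k ∈ s, y k) := by
  have hy : ∀ k ∈ s, 0 ≤ y k := fun k hk => (hx k hk).trans (hxy k hk)
  rcases (Finset.sum_nonneg hy).eq_or_lt with hY | hY
  · have hy0 := (Finset.sum_eq_zero_iff_of_nonneg hy).1 hY.symm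
    rw [← hY, zero_mul, Finset.sum_eq_zero fun k hk => by rw [hy0 k hk, zero_mul]]
  · have hcancel : ∀ k ∈ s, y k * (x k / y k) = x k := fun k hk =>
      mul_div_cancel_of_imp' fun h0 => le_antisymm (h0 ▸ hxy k hk) (hx k hk)
    have hJensen := concaveOn_negMulLog.le_map_centerMass hy hY
      (p := fun k => x k / y k) fun k hk => div_nonneg (hx k hk) (hy k hk)
    simp only [Finset.centerMass, Function.comp_apply, smul_eq_mul, Finset.sum_congr rfl hcancel,
      inv_mul_eq_div] at hJensen
    rwa [div_le_iff₀' hY] at hJensen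

variable {ι : Type*} [Fintype ι] [Nonempty ι] {p : ι → ℝ}

theorem negMulLog_inv_card (ι : Type*) [Fintype ι] :
    negMulLog (Fintype.card ι : ℝ)⁻¹ = (Fintype.card ι : ℝ)⁻¹ * log (Fintype.card ι) := by
  rw [negMulLog, Real.log_inv, neg_mul_neg]

theorem sum_negMulLog_le_log_card (hp : ∀ i, 0 ≤ p i) (hsum : ∑ i, p i = 1) :
    ∑ i, negMulLog (p i) ≤ log (Fintype.card ι) := by
  have hJensen := concaveOn_negMulLog.le_map_sum (t := Finset.univ) (p := p)
    (w := fun _ => (Fintype.card ι : ℝ)⁻¹) (fun _ _ => by positivity) (by simp) fun i _ => hp i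
  simp only [smul_eq_mul, ← Finset.mul_sum, hsum, mul_one, negMulLog_inv_card] at hJensen
  exact le_of_mul_le_mul_left hJensen (by positivity)

theorem eq_inv_card_of_log_card_le_sum_negMulLog (hp : ∀ i, 0 ≤ p i) (hsum : ∑ i, p i = 1)
    (h : log (Fintype.card ι) ≤ ∑ i, negMulLog (p i)) (i : ι) : p i = (Fintype.card ι : ℝ)⁻¹ := by
  have hconst : ∀ j, p j = p i := fun j =>
    strictConcaveOn_negMulLog.eq_of_map_sum_eq (t := Finset.univ) (p := p)
      (w := fun _ => (Fintype.card ι : ℝ)⁻¹) (fun _ _ => by positivity) (by simp)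
      (fun i _ => hp i)
      (by
        simp only [smul_eq_mul, ← Finset.mul_sum, hsum, mul_one, negMulLog_inv_card]
        exact mul_le_mul_of_nonneg_left h (by positivity))
      (Finset.mem_univ j) (Finset.mem_univ i)
  rw [Fintype.sum_congr _ _ hconst, Finset.sum_const, Finset.card_univ, nsmul_eq_mul] at hsum
  exact eq_inv_of_mul_eq_one_right hsum

end NegMulLog

section PartitionEntropy

variable {X ι κ τ : Type*} [MeasurableSpace X] {μ : Measure X}

theorem sum_measureReal_preimage_singleton_inter [MeasurableSpace ι] [MeasurableSingletonClass ι]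
    [IsFiniteMeasure μ] {ξ : X → ι} (hξ : Measurable ξ) (s : Finset ι) (S : Set X) :
    ∑ i ∈ s, μ.real (ξ ⁻¹' {i} ∩ S) = μ.real (ξ ⁻¹' s ∩ S) := by
  have hsum := sum_measureReal_preimage_singleton (μ := μ.restrict S) s
    fun i _ => hξ (measurableSet_singleton i)
  simpa only [measureReal_restrict_apply (hξ (measurableSet_singleton _)),
    measureReal_restrict_apply (hξ s.measurableSet)] using hsum

variable [Fintype ι] [Fintype κ] [Fintype τ]

theorem partitionEntropy_comp_of_injective (ξ : X → ι) {f : ι → κ} (hf : f.Injective) :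
    partitionEntropy μ (f ∘ ξ) = partitionEntropy μ ξ := by
  refine (Fintype.sum_of_injective f hf _ _ (fun k hk => ?_) fun i => ?_).symm
  · have hempty : f ∘ ξ ⁻¹' {k} = ∅ :=
      Set.eq_empty_of_forall_notMem fun x hx => hk ⟨ξ x, hx⟩
    rw [hempty, measureReal_empty, negMulLog_zero]
  · rw [Set.preimage_comp, ← Set.image_singleton, hf.preimage_image]

/-- The conditional entropy `H_μ(ξ | ζ) = ∑ k, μ(ζ = k) H(ξ | ζ = k)` of a finite partition `ξ`
given a finite partition `ζ`, where `H(ξ | ζ = k)` is the entropy of the conditional probabilities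
`μ(ξ = i, ζ = k) / μ(ζ = k)`; atoms of measure zero do not contribute. -/
noncomputable def condPartitionEntropy (μ : Measure X) (ξ : X → ι) (ζ : X → κ) : ℝ :=
  ∑ k, μ.real (ζ ⁻¹' {k}) *
    ∑ i, negMulLog (μ.real (ξ ⁻¹' {i} ∩ ζ ⁻¹' {k}) / μ.real (ζ ⁻¹' {k}))

theorem condPartitionEntropy_nonneg (μ : Measure X) [IsFiniteMeasure μ] (ξ : X → ι) (ζ : X → κ) :
    0 ≤ condPartitionEntropy μ ξ ζ :=
  Finset.sum_nonneg fun _ _ => mul_nonneg measureReal_nonneg <| Finset.sum_nonneg fun _ _ =>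
    negMulLog_nonneg (by positivity) <|
      div_le_one_of_le₀ (measureReal_mono Set.inter_subset_right) measureReal_nonneg

theorem condPartitionEntropy_le_comp_right [MeasurableSpace κ] [MeasurableSingletonClass κ]
    [IsFiniteMeasure μ] (ξ : X → ι) {ζ : X → κ} (hζ : Measurable ζ) (f : κ → τ) :
    condPartitionEntropy μ ξ ζ ≤ condPartitionEntropy μ ξ (f ∘ ζ) := by
  classical
  have hfib (S : Set X) (t : τ) :
      ∑ k with f k = t, μ.real (S ∩ ζ ⁻¹' {k}) = μ.real (S ∩ f ∘ ζ ⁻¹' {t}) := by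
    simp only [Set.inter_comm S, sum_measureReal_preimage_singleton_inter hζ]
    congr 2
    ext x
    simp
  simp only [condPartitionEntropy, Finset.mul_sum]
  rw [Finset.sum_comm, Finset.sum_comm (s := (Finset.univ : Finset τ))]
  refine Finset.sum_le_sum fun i _ => ?_
  rw [← Finset.sum_fiberwise _ f]
  refine Finset.sum_le_sum fun t _ => ?_
  have hlogsum := sum_mul_negMulLog_div_le (s := Finset.univ.filter fun k => f k = t)
    (x := fun k => μ.real (ξ ⁻¹' {i} ∩ ζ ⁻¹' {k})) (y := fun k => μ.real (Set.univ ∩ ζ ⁻¹' {k}))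
    (fun _ _ => measureReal_nonneg) fun _ _ => measureReal_mono (by gcongr; exact Set.subset_univ _)
  simp only [hfib] at hlogsum
  simpa only [Set.univ_inter] using hlogsum

variable [MeasurableSpace ι] [MeasurableSingletonClass ι] {ξ : X → ι} {ζ : X → κ} {ω : X → τ}

theorem partitionEntropy_prodMk [IsFiniteMeasure μ] (hξ : Measurable ξ) (ζ : X → κ) :
    partitionEntropy μ (fun x => (ξ x, ζ x)) =
      partitionEntropy μ ζ + condPartitionEntropy μ ξ ζ := by
  have hpair i k : (fun x => (ξ x, ζ x)) ⁻¹' {(i, k)} = ξ ⁻¹' {i} ∩ ζ ⁻¹' {k} := by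
    rw [← Set.singleton_prod_singleton, Set.mk_preimage_prod]
  have hterm i k := mul_negMulLog_div (x := μ.real (ξ ⁻¹' {i} ∩ ζ ⁻¹' {k}))
    (y := μ.real (ζ ⁻¹' {k})) fun h => measureReal_mono_null Set.inter_subset_right h
  simp only [partitionEntropy, condPartitionEntropy, Fintype.sum_prod_type_right, hpair,
    Finset.mul_sum, hterm, ← Finset.sum_add_distrib]
  refine Finset.sum_congr rfl fun k _ => ?_
  rw [Finset.sum_add_distrib, ← Finset.sum_mul, sum_measureReal_preimage_singleton_inter hξ,
    Finset.coe_univ, Set.preimage_univ, Set.univ_inter, negMulLog]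
  ring

theorem partitionEntropy_comp_le [IsFiniteMeasure μ] (hξ : Measurable ξ) (f : ι → κ) :
    partitionEntropy μ (f ∘ ξ) ≤ partitionEntropy μ ξ :=
  calc partitionEntropy μ (f ∘ ξ)
      ≤ partitionEntropy μ (f ∘ ξ) + condPartitionEntropy μ ξ (f ∘ ξ) :=
        le_add_of_nonneg_right (condPartitionEntropy_nonneg μ ξ _)
    _ = partitionEntropy μ ((fun i => (i, f i)) ∘ ξ) := (partitionEntropy_prodMk hξ _).symm
    _ = partitionEntropy μ ξ :=
        partitionEntropy_comp_of_injective ξ fun _ _ h => congrArg Prod.fst h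

variable [MeasurableSpace κ] [MeasurableSingletonClass κ]

theorem condPartitionEntropy_comp_measurePreserving {T : X → X} (hT : MeasurePreserving T μ μ)
    (hξ : Measurable ξ) (hζ : Measurable ζ) :
    condPartitionEntropy μ (ξ ∘ T) (ζ ∘ T) = condPartitionEntropy μ ξ ζ := by
  have hreal {S : Set X} (hS : MeasurableSet S) : μ.real (T ⁻¹' S) = μ.real S :=
    hT.measureReal_preimage hS.nullMeasurableSet
  have hfib k : MeasurableSet (ζ ⁻¹' {k}) := hζ (measurableSet_singleton k)
  simp only [condPartitionEntropy, Set.preimage_comp, ← Set.preimage_inter, hreal (hfib _),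
    hreal ((hξ (measurableSet_singleton _)).inter (hfib _))]

variable [MeasurableSpace τ] [MeasurableSingletonClass τ]

theorem condPartitionEntropy_comp_left_le [IsFiniteMeasure μ] (hζ : Measurable ζ) (f : κ → ι)
    (hω : Measurable ω) : condPartitionEntropy μ (f ∘ ζ) ω ≤ condPartitionEntropy μ ζ ω := by
  have hle : partitionEntropy μ (fun x => ((f ∘ ζ) x, ω x)) ≤
      partitionEntropy μ fun x => (ζ x, ω x) :=
    partitionEntropy_comp_le (hζ.prodMk hω) (Prod.map f id)
  rwa [partitionEntropy_prodMk hζ, partitionEntropy_prodMk ((measurable_of_finite f).comp hζ),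
    add_le_add_iff_left] at hle

theorem condPartitionEntropy_prodMk_le [IsFiniteMeasure μ] (hξ : Measurable ξ) (hζ : Measurable ζ)
    (hω : Measurable ω) :
    condPartitionEntropy μ (fun x => (ξ x, ζ x)) ω ≤
      condPartitionEntropy μ ξ ω + condPartitionEntropy μ ζ ω := by
  have hassoc : partitionEntropy μ (fun x => ((ξ x, ζ x), ω x)) =
      partitionEntropy μ fun x => (ξ x, (ζ x, ω x)) :=
    (partitionEntropy_comp_of_injective _ (Equiv.prodAssoc ι κ τ).injective).symm
  have hdrop : condPartitionEntropy μ ξ (fun x => (ζ x, ω x)) ≤ condPartitionEntropy μ ξ ω :=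
    condPartitionEntropy_le_comp_right ξ (hζ.prodMk hω) Prod.snd
  rw [partitionEntropy_prodMk (hξ.prodMk hζ), partitionEntropy_prodMk hξ,
    partitionEntropy_prodMk hζ] at hassoc
  linarith

theorem sum_measureReal_inter_div [IsFiniteMeasure μ] (hξ : Measurable ξ) {S : Set X}
    (hS : μ.real S ≠ 0) : ∑ i, μ.real (ξ ⁻¹' {i} ∩ S) / μ.real S = 1 := by
  rw [← Finset.sum_div, sum_measureReal_preimage_singleton_inter hξ, Finset.coe_univ,
    Set.preimage_univ, Set.univ_inter, div_self hS]

variable [Nonempty ι]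

theorem measureReal_mul_sum_negMulLog_le [IsFiniteMeasure μ] (hξ : Measurable ξ) (S : Set X) :
    μ.real S * ∑ i, negMulLog (μ.real (ξ ⁻¹' {i} ∩ S) / μ.real S) ≤
      μ.real S * log (Fintype.card ι) := by
  rcases eq_or_ne (μ.real S) 0 with hS | hS
  · simp [hS]
  · exact mul_le_mul_of_nonneg_left
      (sum_negMulLog_le_log_card (fun _ => by positivity) (sum_measureReal_inter_div hξ hS))
      measureReal_nonneg

theorem sum_measureReal_preimage_singleton_mul [IsProbabilityMeasure μ] (hζ : Measurable ζ)
    (c : ℝ) : ∑ k, μ.real (ζ ⁻¹' {k}) * c = c := by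
  rw [← Finset.sum_mul,
    sum_measureReal_preimage_singleton _ fun k _ => hζ (measurableSet_singleton k),
    Finset.coe_univ, Set.preimage_univ, probReal_univ, one_mul]

theorem condPartitionEntropy_le_log_card [IsProbabilityMeasure μ] (hξ : Measurable ξ)
    (hζ : Measurable ζ) : condPartitionEntropy μ ξ ζ ≤ log (Fintype.card ι) :=
  (Finset.sum_le_sum fun _ _ => measureReal_mul_sum_negMulLog_le hξ _).trans_eq
    (sum_measureReal_preimage_singleton_mul hζ _)

theorem measureReal_inter_eq_of_log_card_le_condPartitionEntropy [IsProbabilityMeasure μ]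
    (hξ : Measurable ξ) (hζ : Measurable ζ)
    (h : log (Fintype.card ι) ≤ condPartitionEntropy μ ξ ζ) (i : ι) (k : κ) :
    μ.real (ξ ⁻¹' {i} ∩ ζ ⁻¹' {k}) = (Fintype.card ι : ℝ)⁻¹ * μ.real (ζ ⁻¹' {k}) := by
  rcases eq_or_ne (μ.real (ζ ⁻¹' {k})) 0 with hk | hk
  · rw [hk, mul_zero, measureReal_mono_null Set.inter_subset_right hk]
  have hall := (Finset.sum_eq_sum_iff_of_le
    fun k (_ : k ∈ Finset.univ) => measureReal_mul_sum_negMulLog_le hξ (ζ ⁻¹' {k})).1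
    (((condPartitionEntropy_le_log_card hξ hζ).antisymm h).trans
      (sum_measureReal_preimage_singleton_mul hζ _).symm)
  have hmax := mul_left_cancel₀ hk (hall k (Finset.mem_univ k))
  rw [← div_eq_iff hk]
  exact eq_inv_card_of_log_card_le_sum_negMulLog (fun _ => by positivity)
    (sum_measureReal_inter_div hξ hk) hmax.ge i

end PartitionEntropy

section Itinerary

variable {X ι κ : Type*} {T : X → X}

theorem itinerary_succ_last (T : X → X) (P : X → κ) (n : ℕ) :
    itinerary T P (n + 1) =
      (Fin.snocEquiv fun _ => κ) ∘ fun x => (P (T^[n] x), itinerary T P n x) :=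
  funext fun x => (Fin.snoc_init_self (itinerary T P (n + 1) x)).symm

theorem preimage_itinerary_zero (T : X → X) (P : X → κ) (w : Fin 0 → κ) :
    itinerary T P 0 ⁻¹' {w} = Set.univ :=
  Set.eq_univ_of_forall fun _ => Subsingleton.elim _ _

theorem preimage_itinerary_succ_last (T : X → X) (P : X → κ) {n : ℕ} (w : Fin (n + 1) → κ) :
    itinerary T P (n + 1) ⁻¹' {w} =
      P ∘ T^[n] ⁻¹' {w (Fin.last n)} ∩ itinerary T P n ⁻¹' {Fin.init w} := by
  rw [itinerary_succ_last, Set.preimage_comp, ← Equiv.image_symm_eq_preimage, Set.image_singleton]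
  ext x
  exact Prod.ext_iff

theorem preimage_itinerary_succ (T : X → X) (P : X → κ) {n : ℕ} (w : Fin (n + 1) → κ) :
    itinerary T P (n + 1) ⁻¹' {w} = T ⁻¹' (itinerary T P n ⁻¹' {Fin.tail w}) ∩ P ⁻¹' {w 0} := by
  ext x
  exact (funext_iff.trans Fin.forall_fin_succ).trans <|
    and_comm.trans (and_congr_left' funext_iff.symm)

variable [MeasurableSpace X]

theorem measurable_itinerary [MeasurableSpace ι] (hT : Measurable T) {ξ : X → ι}
    (hξ : Measurable ξ) (n : ℕ) : Measurable (itinerary T ξ n) :=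
  measurable_pi_iff.2 fun i => hξ.comp (hT.iterate i)

variable [Fintype κ] {P : X → κ} {μ : Measure X}

/-- The entropy of `T` relative to a finite partition `P`, as a real number: the infimum (and limit)
of the conditional entropies of the `n`-th symbol of the itinerary given the previous ones. -/
noncomputable def entropyRate (T : X → X) (μ : Measure X) (P : X → κ) : ℝ :=
  ⨅ n, condPartitionEntropy μ (P ∘ T^[n]) (itinerary T P n)

theorem entropyRate_le_condPartitionEntropy [IsFiniteMeasure μ] (n : ℕ) :
    entropyRate T μ P ≤ condPartitionEntropy μ (P ∘ T^[n]) (itinerary T P n) :=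
  ciInf_le ⟨0, Set.forall_mem_range.2 fun _ => condPartitionEntropy_nonneg μ _ _⟩ n

variable [Fintype ι] [MeasurableSpace ι] [MeasurableSingletonClass ι] {ξ : X → ι}
  [MeasurableSpace κ] [MeasurableSingletonClass κ]

theorem partitionEntropy_itinerary_succ [IsFiniteMeasure μ] (hT : Measurable T) (hP : Measurable P)
    (n : ℕ) :
    partitionEntropy μ (itinerary T P (n + 1)) =
      partitionEntropy μ (itinerary T P n) +
        condPartitionEntropy μ (P ∘ T^[n]) (itinerary T P n) := by
  rw [itinerary_succ_last, partitionEntropy_comp_of_injective _ (Equiv.injective _)]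
  exact partitionEntropy_prodMk (hP.comp (hT.iterate n)) _

theorem partitionEntropy_itinerary_eq_sum [IsProbabilityMeasure μ] (hT : Measurable T)
    (hP : Measurable P) (n : ℕ) :
    partitionEntropy μ (itinerary T P n) =
      ∑ i ∈ Finset.range n, condPartitionEntropy μ (P ∘ T^[i]) (itinerary T P i) := by
  induction n with
  | zero => simp [partitionEntropy, preimage_itinerary_zero]
  | succ n ih => rw [partitionEntropy_itinerary_succ hT hP, ih, Finset.sum_range_succ]

theorem condPartitionEntropy_itinerary_antitone [IsFiniteMeasure μ] (hT : MeasurePreserving T μ μ)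
    (hP : Measurable P) :
    Antitone fun n => condPartitionEntropy μ (P ∘ T^[n]) (itinerary T P n) := by
  refine antitone_nat_of_succ_le fun n => ?_
  have htail : itinerary T P n ∘ T = Fin.tail ∘ itinerary T P (n + 1) := rfl
  rw [← condPartitionEntropy_comp_measurePreserving hT (hP.comp (hT.measurable.iterate n))
    (measurable_itinerary hT.measurable hP n), htail, Function.comp_assoc, ← Function.iterate_succ]
  exact condPartitionEntropy_le_comp_right _ (measurable_itinerary hT.measurable hP (n + 1)) _

theorem condPartitionEntropy_itinerary_le [IsProbabilityMeasure μ] {τ : Type*} [Fintype τ]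
    [MeasurableSpace τ] [MeasurableSingletonClass τ] {ζ : X → τ} (hT : Measurable T)
    (hξ : Measurable ξ) (hζ : Measurable ζ) (n : ℕ) :
    condPartitionEntropy μ (itinerary T ξ n) ζ ≤
      ∑ i ∈ Finset.range n, condPartitionEntropy μ (ξ ∘ T^[i]) ζ := by
  induction n with
  | zero => simpa using condPartitionEntropy_le_log_card (measurable_itinerary hT hξ 0) hζ
  | succ n ih =>
    have hn := measurable_itinerary hT hξ n
    have hξn := hξ.comp (hT.iterate n)
    calc condPartitionEntropy μ (itinerary T ξ (n + 1)) ζ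
        ≤ condPartitionEntropy μ (fun x => (ξ (T^[n] x), itinerary T ξ n x)) ζ := by
          rw [itinerary_succ_last]
          exact condPartitionEntropy_comp_left_le (hξn.prodMk hn) _ hζ
      _ ≤ condPartitionEntropy μ (ξ ∘ T^[n]) ζ + condPartitionEntropy μ (itinerary T ξ n) ζ :=
          condPartitionEntropy_prodMk_le hξn hn hζ
      _ ≤ ∑ i ∈ Finset.range (n + 1), condPartitionEntropy μ (ξ ∘ T^[i]) ζ := by
          rw [Finset.sum_range_succ_comm]
          gcongr

theorem condPartitionEntropy_iterate_le [IsFiniteMeasure μ] (hT : MeasurePreserving T μ μ)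
    (hξ : Measurable ξ) (hP : Measurable P) {i m M : ℕ} (h : i + m ≤ M) :
    condPartitionEntropy μ (ξ ∘ T^[i]) (itinerary T P M) ≤
      condPartitionEntropy μ ξ (itinerary T P m) := by
  have hshift : itinerary T P m ∘ T^[i] =
      (fun w (j : Fin m) => w ⟨i + j, by omega⟩) ∘ itinerary T P M := by
    funext x j
    simp only [itinerary, Function.comp_apply, add_comm i, Function.iterate_add_apply]
  rw [← condPartitionEntropy_comp_measurePreserving (hT.iterate i) hξ
    (measurable_itinerary hT.measurable hP m), hshift]
  exact condPartitionEntropy_le_comp_right _ (measurable_itinerary hT.measurable hP M) _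

theorem partitionEntropy_itinerary_le [IsProbabilityMeasure μ] (hT : MeasurePreserving T μ μ)
    (hξ : Measurable ξ) (hP : Measurable P) (n m : ℕ) :
    partitionEntropy μ (itinerary T ξ n) ≤
      partitionEntropy μ (itinerary T P (n + m)) +
        n * condPartitionEntropy μ ξ (itinerary T P m) := by
  have hPn := measurable_itinerary hT.measurable hP (n + m)
  have hξn := measurable_itinerary hT.measurable hξ n
  calc partitionEntropy μ (itinerary T ξ n)
      ≤ partitionEntropy μ (fun x => (itinerary T ξ n x, itinerary T P (n + m) x)) :=
        partitionEntropy_comp_le (hξn.prodMk hPn) Prod.fst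
    _ = partitionEntropy μ (itinerary T P (n + m)) +
        condPartitionEntropy μ (itinerary T ξ n) (itinerary T P (n + m)) :=
        partitionEntropy_prodMk hξn _
    _ ≤ partitionEntropy μ (itinerary T P (n + m)) +
        ∑ i ∈ Finset.range n, condPartitionEntropy μ (ξ ∘ T^[i]) (itinerary T P (n + m)) := by
        gcongr
        exact condPartitionEntropy_itinerary_le hT.measurable hξ hPn n
    _ ≤ partitionEntropy μ (itinerary T P (n + m)) +
        ∑ _i ∈ Finset.range n, condPartitionEntropy μ ξ (itinerary T P m) := by
        gcongr with i hi
        exact condPartitionEntropy_iterate_le hT hξ hP (by grind)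
    _ = _ := by rw [Finset.sum_const, Finset.card_range, nsmul_eq_mul]

theorem tendsto_partitionEntropy_itinerary_div [IsProbabilityMeasure μ]
    (hT : MeasurePreserving T μ μ) (hP : Measurable P) :
    Tendsto (fun n : ℕ => partitionEntropy μ (itinerary T P n) / n) atTop
      (𝓝 (entropyRate T μ P)) := by
  have hlim := tendsto_atTop_ciInf (condPartitionEntropy_itinerary_antitone hT hP)
    ⟨0, Set.forall_mem_range.2 fun n => condPartitionEntropy_nonneg μ _ _⟩
  refine hlim.cesaro.congr fun n => ?_
  rw [partitionEntropy_itinerary_eq_sum hT.measurable hP, inv_mul_eq_div]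

theorem entropyOfPartition_eq_entropyRate [IsProbabilityMeasure μ]
    (hT : MeasurePreserving T μ μ) (hP : Measurable P) :
    entropyOfPartition T μ P = entropyRate T μ P :=
  ((continuous_coe_real_ereal.tendsto _).comp
    (tendsto_partitionEntropy_itinerary_div hT hP)).limsup_eq

theorem entropyRate_le_entropyRate_add_condPartitionEntropy [IsProbabilityMeasure μ]
    (hT : MeasurePreserving T μ μ) (hξ : Measurable ξ) (hP : Measurable P) (m : ℕ) :
    entropyRate T μ ξ ≤ entropyRate T μ P + condPartitionEntropy μ ξ (itinerary T P m) := by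
  have hratio : Tendsto (fun n : ℕ => ((n + m : ℕ) : ℝ) / n) atTop (𝓝 1) := by
    simpa [add_comm] using tendsto_add_mul_div_add_mul_atTop_nhds (m : ℝ) 0 1 one_ne_zero
  have hshift := (((tendsto_partitionEntropy_itinerary_div hT hP).comp
    (tendsto_add_atTop_nat m)).mul hratio).add_const
    (condPartitionEntropy μ ξ (itinerary T P m))
  rw [mul_one] at hshift
  refine le_of_tendsto_of_tendsto (tendsto_partitionEntropy_itinerary_div hT hξ) hshift ?_
  filter_upwards [eventually_gt_atTop 0] with n hn
  have hn0 : (0 : ℝ) < n := by exact_mod_cast hn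
  have hnm : ((n + m : ℕ) : ℝ) ≠ 0 := by positivity
  rw [Function.comp_apply, div_mul_div_cancel₀ hnm, div_add' _ _ _ hn0.ne',
    div_le_div_iff_of_pos_right hn0, mul_comm _ (n : ℝ)]
  exact partitionEntropy_itinerary_le hT hξ hP n m

end Itinerary

section Generator

variable {X ι κ : Type*} {T : X → X}

theorem comap_itinerary_mono [MeasurableSpace κ] (T : X → X) (P : X → κ) :
    Monotone fun n => MeasurableSpace.comap (itinerary T P n) inferInstance :=
  fun m n hmn => ((measurable_pi_lambda (fun (w : Fin n → κ) (j : Fin m) => w (Fin.castLE hmn j))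
    fun _ => measurable_pi_apply _).comp (comap_measurable (itinerary T P n))).comap_le

variable [MeasurableSpace X] {μ : Measure X}

/-- `P` is a generator for `T`: the finite itineraries with respect to `P` generate the σ-algebra
of `X`. -/
def IsGenerator [MeasurableSpace κ] (T : X → X) (P : X → κ) : Prop :=
  ‹MeasurableSpace X› ≤ ⨆ n, MeasurableSpace.comap (itinerary T P n) inferInstance

theorem isGenerator_of_injective [StandardBorelSpace X] [MeasurableSpace κ]
    [Countable κ] [MeasurableSingletonClass κ] {P : X → κ} (hT : Measurable T) (hP : Measurable P)
    (hinj : Function.Injective fun x (n : ℕ) => P (T^[n] x)) : IsGenerator T P := by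
  have hcode : Measurable fun x (n : ℕ) => P (T^[n] x) :=
    measurable_pi_iff.2 fun n => hP.comp (hT.iterate n)
  refine (hcode.measurableEmbedding hinj).comap_eq.ge.trans ?_
  rw [MeasurableSpace.pi, MeasurableSpace.comap_iSup]
  refine iSup_mono' fun n => ⟨n + 1, ?_⟩
  rw [MeasurableSpace.comap_comp]
  exact ((measurable_pi_apply (Fin.last n)).comp
    (comap_measurable (itinerary T P (n + 1)))).comap_le

variable [MeasurableSpace κ] [MeasurableSingletonClass κ] {P : X → κ}

theorem IsGenerator.measure_eq [Finite κ] (hgen : IsGenerator T P) (hT : Measurable T)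
    (hP : Measurable P) [IsProbabilityMeasure μ] {ν : Measure X} [IsProbabilityMeasure ν]
    (h : ∀ n (w : Fin n → κ), μ.real (itinerary T P n ⁻¹' {w}) = ν.real (itinerary T P n ⁻¹' {w})) :
    μ = ν := by
  have hmeas := measurable_itinerary hT hP
  let m : ℕ → MeasurableSpace X := fun n => MeasurableSpace.comap (itinerary T P n) inferInstance
  refine ext_of_generate_finite (⋃ n, {s | MeasurableSet[m n] s}) ?_
    (isPiSystem_iUnion_of_monotone _ (fun n => @MeasurableSpace.isPiSystem_measurableSet _ (m n))
      fun _ _ hmn => comap_itinerary_mono T P hmn) ?_ (by simp only [measure_univ])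
  · exact (hgen.antisymm (iSup_le fun n => (hmeas n).comap_le)).trans
      (MeasurableSpace.generateFrom_iUnion_measurableSet m).symm
  · intro s hs
    obtain ⟨n, D, -, rfl⟩ := Set.mem_iUnion.1 hs
    have hD := D.toFinite.measurableSet
    rw [← Measure.map_apply (hmeas n) hD, ← Measure.map_apply (hmeas n) hD]
    congr 1
    refine Measure.ext_of_singleton fun w => ?_
    rw [Measure.map_apply (hmeas n) (measurableSet_singleton w),
      Measure.map_apply (hmeas n) (measurableSet_singleton w)]
    exact (measureReal_eq_measureReal_iff).1 (h n w)

theorem integral_comp_eq_sum [Fintype κ] [IsFiniteMeasure μ] {ζ : X → κ} (hζ : Measurable ζ)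
    (g : κ → ℝ) :
    ∫ x, g (ζ x) ∂μ = ∑ k, μ.real (ζ ⁻¹' {k}) * g k := by
  rw [← integral_map hζ.aemeasurable (measurable_of_finite g).aestronglyMeasurable,
    integral_fintype Integrable.of_finite]
  simp only [map_measureReal_apply hζ (measurableSet_singleton _), smul_eq_mul]

theorem measureReal_inter_div_ae_eq_condExp [Finite κ] [IsFiniteMeasure μ] {ζ : X → κ}
    (hζ : Measurable ζ) {A : Set X} (hA : MeasurableSet A) :
    (fun x => μ.real (A ∩ ζ ⁻¹' {ζ x}) / μ.real (ζ ⁻¹' {ζ x})) =ᵐ[μ]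
      μ[A.indicator 1 | MeasurableSpace.comap ζ inferInstance] := by
  cases nonempty_fintype κ
  let q : κ → ℝ := fun k => μ.real (A ∩ ζ ⁻¹' {k}) / μ.real (ζ ⁻¹' {k})
  have hqζ : StronglyMeasurable[MeasurableSpace.comap ζ inferInstance] (q ∘ ζ) :=
    ((measurable_of_finite q).comp (comap_measurable ζ)).stronglyMeasurable
  have hq : Integrable (q ∘ ζ) μ :=
    (Integrable.of_finite (μ := μ.map ζ)).comp_measurable hζ
  have hfib k : MeasurableSet (ζ ⁻¹' {k}) := hζ (measurableSet_singleton k)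
  refine ae_eq_condExp_of_forall_setIntegral_eq hζ.comap_le
    ((integrable_const (1 : ℝ)).indicator hA) (fun _ _ _ => hq.integrableOn) ?_
    hqζ.aestronglyMeasurable
  rintro _ ⟨D, -, rfl⟩ -
  have hterm k : μ.real (ζ ⁻¹' {k} ∩ ζ ⁻¹' D) * q k =
      μ.real (ζ ⁻¹' {k} ∩ (A ∩ ζ ⁻¹' D)) := by
    by_cases hk : k ∈ D
    · have hsub : ζ ⁻¹' {k} ⊆ ζ ⁻¹' D := Set.preimage_mono (Set.singleton_subset_iff.2 hk)
      rw [Set.inter_eq_left.2 hsub, Set.inter_left_comm, Set.inter_eq_left.2 hsub,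
        mul_div_cancel_of_imp' (measureReal_mono_null Set.inter_subset_right)]
    · have hdisj : Disjoint (ζ ⁻¹' {k}) (ζ ⁻¹' D) :=
        Disjoint.preimage ζ (Set.disjoint_singleton_left.2 hk)
      rw [hdisj.inter_eq, (hdisj.mono_right Set.inter_subset_right).inter_eq, measureReal_empty,
        zero_mul]
  rw [integral_comp_eq_sum (μ := μ.restrict (ζ ⁻¹' D)) hζ q]
  simp only [measureReal_restrict_apply (hfib _), hterm]
  rw [sum_measureReal_preimage_singleton_inter hζ, Finset.coe_univ, Set.preimage_univ,
    Set.univ_inter, setIntegral_indicator hA]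
  simp [Set.inter_comm]

theorem condPartitionEntropy_eq_sum_integral [Fintype κ] [IsFiniteMeasure μ] [Fintype ι] (ξ : X → ι)
    {ζ : X → κ} (hζ : Measurable ζ) :
    condPartitionEntropy μ ξ ζ =
      ∑ i, ∫ x, negMulLog (μ.real (ξ ⁻¹' {i} ∩ ζ ⁻¹' {ζ x}) / μ.real (ζ ⁻¹' {ζ x})) ∂μ := by
  simp only [condPartitionEntropy, Finset.mul_sum]
  rw [Finset.sum_comm]
  exact Finset.sum_congr rfl fun i _ => (integral_comp_eq_sum hζ fun k =>
    negMulLog (μ.real (ξ ⁻¹' {i} ∩ ζ ⁻¹' {k}) / μ.real (ζ ⁻¹' {k}))).symm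

theorem IsGenerator.tendsto_measureReal_inter_div [Finite κ] [IsFiniteMeasure μ]
    (hgen : IsGenerator T P) (hT : Measurable T) (hP : Measurable P) {A : Set X}
    (hA : MeasurableSet A) :
    ∀ᵐ x ∂μ, Tendsto (fun n => μ.real (A ∩ itinerary T P n ⁻¹' {itinerary T P n x}) /
      μ.real (itinerary T P n ⁻¹' {itinerary T P n x})) atTop (𝓝 (A.indicator 1 x)) := by
  let ℱ : Filtration ℕ ‹MeasurableSpace X› :=
    ⟨fun n => MeasurableSpace.comap (itinerary T P n) inferInstance, comap_itinerary_mono T P,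
      fun n => (measurable_itinerary hT hP n).comap_le⟩
  have hLevy := ((integrable_const (1 : ℝ)).indicator hA).tendsto_ae_condExp (μ := μ) (ℱ := ℱ)
    (stronglyMeasurable_one.indicator (hgen A hA))
  filter_upwards [hLevy, ae_all_iff.2 fun n =>
    measureReal_inter_div_ae_eq_condExp (measurable_itinerary hT hP n) hA] with x hx heq
  exact hx.congr fun n => (heq n).symm

variable [Fintype κ]

theorem IsGenerator.tendsto_condPartitionEntropy [IsFiniteMeasure μ] [Fintype ι]
    [MeasurableSpace ι] [MeasurableSingletonClass ι] {ξ : X → ι} (hgen : IsGenerator T P)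
    (hT : Measurable T) (hP : Measurable P) (hξ : Measurable ξ) :
    Tendsto (fun n => condPartitionEntropy μ ξ (itinerary T P n)) atTop (𝓝 0) := by
  have hterm i : Tendsto (fun n => ∫ x, negMulLog (μ.real (ξ ⁻¹' {i} ∩
      itinerary T P n ⁻¹' {itinerary T P n x}) / μ.real (itinerary T P n ⁻¹' {itinerary T P n x}))
      ∂μ) atTop (𝓝 (∫ _, 0 ∂μ)) := by
    refine tendsto_integral_of_dominated_convergence (fun _ => 1) (fun n => ?_)
      (integrable_const _) (fun n => Eventually.of_forall fun x => ?_) ?_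
    · exact ((measurable_of_finite fun w => negMulLog (μ.real (ξ ⁻¹' {i} ∩
        itinerary T P n ⁻¹' {w}) / μ.real (itinerary T P n ⁻¹' {w}))).comp
        (measurable_itinerary hT hP n)).aestronglyMeasurable
    · set p := μ.real (ξ ⁻¹' {i} ∩ itinerary T P n ⁻¹' {itinerary T P n x}) /
        μ.real (itinerary T P n ⁻¹' {itinerary T P n x})
      have hp0 : 0 ≤ p := by positivity
      have hp1 : p ≤ 1 :=
        div_le_one_of_le₀ (measureReal_mono Set.inter_subset_right) measureReal_nonneg
      rw [Real.norm_of_nonneg (negMulLog_nonneg hp0 hp1)]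
      linarith [negMulLog_le_one_sub_self hp0]
    · filter_upwards [hgen.tendsto_measureReal_inter_div (μ := μ) hT hP
        (hξ (measurableSet_singleton i))] with x hx
      have hzero : negMulLog ((ξ ⁻¹' {i}).indicator 1 x) = 0 := by
        rcases Set.indicator_eq_zero_or_self (ξ ⁻¹' {i}) (1 : X → ℝ) x with h | h <;> simp [h]
      rw [← hzero]
      exact (continuous_negMulLog.tendsto _).comp hx
  simp only [condPartitionEntropy_eq_sum_integral ξ (measurable_itinerary hT hP _)]
  simpa using tendsto_finsetSum Finset.univ fun i _ => hterm i

theorem entropyOfPartition_le_measureEntropy (hP : Measurable P) :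
    entropyOfPartition T μ P ≤ measureEntropy T μ := by
  let e : κ ≃ Fin (Fintype.card κ) := Fintype.equivFin κ
  have hrelabel n : partitionEntropy μ (itinerary T (e ∘ P) n) =
      partitionEntropy μ (itinerary T P n) :=
    partitionEntropy_comp_of_injective (itinerary T P n) e.injective.comp_left
  have heq : entropyOfPartition T μ (e ∘ P) = entropyOfPartition T μ P := by
    simp only [entropyOfPartition, hrelabel]
  rw [← heq]
  exact le_iSup₂_of_le (Fintype.card κ) (e ∘ P)
    (le_iSup_of_le ((measurable_of_finite e).comp hP) le_rfl)

variable [IsProbabilityMeasure μ]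

theorem IsGenerator.measureEntropy_eq (hgen : IsGenerator T P) (hT : MeasurePreserving T μ μ)
    (hP : Measurable P) : measureEntropy T μ = entropyRate T μ P := by
  refine le_antisymm (iSup_le fun k => iSup₂_le fun ξ hξ => ?_) ?_
  · rw [entropyOfPartition_eq_entropyRate hT hξ, EReal.coe_le_coe_iff]
    have hlim := (hgen.tendsto_condPartitionEntropy (μ := μ) hT.measurable hP hξ).const_add
      (entropyRate T μ P)
    rw [add_zero] at hlim
    exact ge_of_tendsto' hlim fun m =>
      entropyRate_le_entropyRate_add_condPartitionEntropy hT hξ hP m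
  · rw [← entropyOfPartition_eq_entropyRate hT hP]
    exact entropyOfPartition_le_measureEntropy hP

variable [Nonempty κ]

theorem measureReal_cylinder_of_log_card_le_entropyRate (hT : Measurable T) (hP : Measurable P)
    (h : log (Fintype.card κ) ≤ entropyRate T μ P) (n : ℕ) (w : Fin n → κ) :
    μ.real (itinerary T P n ⁻¹' {w}) = ((Fintype.card κ : ℝ) ^ n)⁻¹ := by
  induction n with
  | zero => rw [preimage_itinerary_zero, probReal_univ, pow_zero, inv_one]
  | succ n ih =>
    rw [preimage_itinerary_succ_last, measureReal_inter_eq_of_log_card_le_condPartitionEntropy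
      (hP.comp (hT.iterate n)) (measurable_itinerary hT hP n)
      (h.trans (entropyRate_le_condPartitionEntropy n)), ih, pow_succ', mul_inv]

theorem entropyRate_eq_log_card (hT : MeasurePreserving T μ μ) (hP : Measurable P)
    (h : ∀ n (w : Fin n → κ), μ.real (itinerary T P n ⁻¹' {w}) = ((Fintype.card κ : ℝ) ^ n)⁻¹) :
    entropyRate T μ P = log (Fintype.card κ) := by
  refine tendsto_nhds_unique (tendsto_partitionEntropy_itinerary_div hT hP)
    (tendsto_const_nhds.congr' ?_)
  filter_upwards [eventually_gt_atTop 0] with n hn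
  simp only [partitionEntropy, h, negMulLog, Finset.sum_const, Finset.card_univ,
    Fintype.card_fun, Fintype.card_fin, nsmul_eq_mul, Real.log_inv, Real.log_pow]
  push_cast
  field_simp

theorem IsGenerator.measureEntropy_eq_log_card_iff (hgen : IsGenerator T P)
    (hT : MeasurePreserving T μ μ) (hP : Measurable P) :
    measureEntropy T μ = log (Fintype.card κ) ↔ ∀ n (w : Fin n → κ),
      μ.real (itinerary T P n ⁻¹' {w}) = ((Fintype.card κ : ℝ) ^ n)⁻¹ := by
  rw [hgen.measureEntropy_eq hT hP, EReal.coe_eq_coe_iff]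
  exact ⟨fun h => measureReal_cylinder_of_log_card_le_entropyRate hT.measurable hP h.ge,
    entropyRate_eq_log_card hT hP⟩

end Generator

section CircleMul

variable {N : ℕ}

/-- Multiplication by `N` on the circle `ℝ / ℤ`. -/
def circleMul (N : ℕ) : UnitAddCircle → UnitAddCircle := fun x => N • x

theorem circleMul_iterate_apply (n : ℕ) (x : UnitAddCircle) : (circleMul N)^[n] x = N ^ n • x :=
  smul_iterate_apply N n x

theorem circleMul_coe (t : ℝ) : circleMul N t = ((N * t : ℝ) : UnitAddCircle) := by
  rw [circleMul, ← AddCircle.coe_nsmul, nsmul_eq_mul]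

theorem measurable_circleMul : Measurable (circleMul N) := (continuous_nsmul N).measurable

theorem exists_coe_eq_and_abs_eq_norm (x : UnitAddCircle) :
    ∃ t : ℝ, (t : UnitAddCircle) = x ∧ |t| = ‖x‖ := by
  obtain ⟨t, rfl⟩ := QuotientAddGroup.mk_surjective x
  refine ⟨t - round t, ?_, UnitAddCircle.norm_eq.symm⟩
  rw [AddCircle.coe_sub, sub_eq_self, AddCircle.coe_eq_zero_iff]
  exact ⟨round t, zsmul_one _⟩

section Torsion

variable {m : ℕ} [NeZero m]

/-- The `m`-torsion points `k / m` of the circle `ℝ / ℤ`. -/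
noncomputable def circleTorsion (m : ℕ) [NeZero m] : Finset UnitAddCircle :=
  Finset.univ.map ⟨ZMod.toAddCircle, ZMod.toAddCircle_injective m⟩

theorem card_circleTorsion : (circleTorsion m).card = m := by
  rw [circleTorsion, Finset.card_map, Finset.card_univ, ZMod.card]

theorem nsmul_eq_zero_of_mem_circleTorsion {x : UnitAddCircle} (hx : x ∈ circleTorsion m) :
    m • x = 0 := by
  obtain ⟨k, -, rfl⟩ := Finset.mem_map.1 hx
  rw [Function.Embedding.coeFn_mk, ← map_nsmul, nsmul_eq_mul, ZMod.natCast_self, zero_mul, map_zero]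

theorem exists_mem_circleTorsion_dist_le (x : UnitAddCircle) :
    ∃ y ∈ circleTorsion m, dist x y ≤ (2 * m : ℝ)⁻¹ := by
  obtain ⟨t, rfl⟩ := QuotientAddGroup.mk_surjective x
  have hm : (0 : ℝ) < m := by exact_mod_cast NeZero.pos m
  refine ⟨ZMod.toAddCircle (round (m * t) : ZMod m),
    Finset.mem_map_of_mem _ (Finset.mem_univ _), ?_⟩
  rw [ZMod.toAddCircle_intCast, dist_eq_norm, ← AddCircle.coe_sub]
  calc ‖((t - round (m * t) / m : ℝ) : UnitAddCircle)‖
      ≤ |t - round (m * t) / m| := QuotientAddGroup.norm_mk_le_norm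
    _ = |m * t - round (m * t)| / m := by
        rw [← abs_of_pos hm, ← abs_div, abs_of_pos hm, sub_div, mul_div_cancel_left₀ _ hm.ne']
    _ ≤ 1 / 2 / m := by gcongr; exact abs_sub_round _
    _ = (2 * m : ℝ)⁻¹ := by rw [div_div, one_div]

end Torsion

variable [NeZero N]

theorem norm_nsmul_eq_of_norm_le {x : UnitAddCircle} (hx : ‖x‖ ≤ (2 * N : ℝ)⁻¹) :
    ‖N • x‖ = N * ‖x‖ := by
  obtain ⟨t, rfl, ht⟩ := exists_coe_eq_and_abs_eq_norm x
  have hN : (0 : ℝ) < N := by exact_mod_cast NeZero.pos N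
  rw [← AddCircle.coe_nsmul, nsmul_eq_mul, ← ht, ← abs_of_pos hN, ← abs_mul, abs_of_pos hN,
    AddCircle.norm_coe_eq_abs_iff 1 one_ne_zero, abs_mul, abs_of_pos hN, ht, abs_one]
  calc N * ‖(t : UnitAddCircle)‖ ≤ N * (2 * N : ℝ)⁻¹ := by gcongr
    _ = 1 / 2 := by field_simp

theorem norm_pow_nsmul_eq_of_norm_le {x : UnitAddCircle} {n : ℕ}
    (hx : ∀ k < n, ‖N ^ k • x‖ ≤ (2 * N : ℝ)⁻¹) : ‖N ^ n • x‖ = N ^ n * ‖x‖ := by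
  induction n with
  | zero => simp
  | succ n ih =>
    rw [pow_succ', mul_nsmul', norm_nsmul_eq_of_norm_le (hx n n.lt_succ_self),
      ih fun k hk => hx k (hk.trans n.lt_succ_self), pow_succ', mul_assoc]

theorem isDynCoverOf_circleMul {M n : ℕ} {U : SetRel UnitAddCircle UnitAddCircle}
    (hU : ∀ ⦃x y⦄, dist x y ≤ ((N : ℝ) ^ M)⁻¹ → (x, y) ∈ U) :
    Dynamics.IsDynCoverOf (circleMul N) Set.univ U n (circleTorsion (N ^ (n + M))) := by
  intro x _
  obtain ⟨y, hy, hxy⟩ := exists_mem_circleTorsion_dist_le (m := N ^ (n + M)) x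
  refine ⟨y, hy, Dynamics.mem_dynEntourage.2 fun k hk => hU ?_⟩
  have hN : (1 : ℝ) ≤ N := by exact_mod_cast NeZero.one_le
  have hN0 : (0 : ℝ) < N := one_pos.trans_le hN
  rw [circleMul_iterate_apply, circleMul_iterate_apply, dist_eq_norm, ← nsmul_sub]
  calc ‖N ^ k • (x - y)‖ ≤ (N ^ k : ℕ) * ‖x - y‖ := norm_nsmul_le
    _ ≤ N ^ n * (N ^ (n + M) : ℝ)⁻¹ := by
        rw [← dist_eq_norm, Nat.cast_pow]
        gcongr
        exact hxy.trans (inv_anti₀ (by positivity) (by push_cast; linarith [pow_pos hN0 (n + M)]))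
    _ = ((N : ℝ) ^ M)⁻¹ := by rw [pow_add, mul_inv, mul_inv_cancel_left₀ (by positivity)]

theorem isDynNetIn_circleMul (n : ℕ) :
    Dynamics.IsDynNetIn (circleMul N) Set.univ {p | dist p.1 p.2 < (4 * N : ℝ)⁻¹} n
      (circleTorsion (N ^ n)) := by
  refine ⟨Set.subset_univ _, fun x hx y hy hxy => Set.disjoint_left.2 fun z hxz hyz => hxy ?_⟩
  have hclose : ∀ k < n, ‖N ^ k • (x - y)‖ ≤ (2 * N : ℝ)⁻¹ := fun k hk => by
    have hx' : dist _ _ < _ := Dynamics.mem_ball_dynEntourage.1 hxz k hk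
    have hy' : dist _ _ < _ := Dynamics.mem_ball_dynEntourage.1 hyz k hk
    rw [nsmul_sub, ← dist_eq_norm, ← circleMul_iterate_apply, ← circleMul_iterate_apply]
    calc dist ((circleMul N)^[k] x) ((circleMul N)^[k] y)
        ≤ (4 * N : ℝ)⁻¹ + (4 * N : ℝ)⁻¹ :=
          (dist_triangle_right _ _ _).trans (add_le_add hx'.le hy'.le)
      _ = (2 * N : ℝ)⁻¹ := by field_simp; norm_num
  have hexpand := norm_pow_nsmul_eq_of_norm_le hclose
  rw [nsmul_sub, nsmul_eq_zero_of_mem_circleTorsion hx, nsmul_eq_zero_of_mem_circleTorsion hy,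
    sub_zero, norm_zero, zero_eq_mul] at hexpand
  exact sub_eq_zero.1 (norm_eq_zero.1 (hexpand.resolve_left (pow_ne_zero n (NeZero.ne _))))

theorem coverEntropy_circleMul (hN : 1 < N) :
    Dynamics.coverEntropy (circleMul N) Set.univ = (log N : ℝ) := by
  have hlog : ((log N : ℝ) : EReal) = ENNReal.log (N : ENNReal) := by
    rw [← ENNReal.ofReal_natCast, ENNReal.log_ofReal_of_pos (by positivity)]
  rw [hlog, ← ExpGrowth.expGrowthSup_pow]
  apply le_antisymm
  · refine iSup₂_le fun U hU => ?_
    obtain ⟨ε, hε, hεU⟩ := Metric.mem_uniformity_dist.1 hU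
    obtain ⟨M, hM⟩ := exists_pow_lt_of_lt_one hε
      (inv_lt_one_of_one_lt₀ (by exact_mod_cast hN : (1 : ℝ) < N))
    rw [inv_pow] at hM
    refine ExpGrowth.expGrowthSup_le_of_eventually_le (b := (N : ENNReal) ^ M)
      (ENNReal.pow_ne_top (ENNReal.natCast_ne_top N)) (Eventually.of_forall fun n => ?_)
    have hcover := (isDynCoverOf_circleMul (N := N) (n := n)
      fun x y hxy => hεU (hxy.trans_lt hM)).coverMincard_le_card
    rw [card_circleTorsion, pow_add, mul_comm] at hcover
    exact_mod_cast ENat.toENNReal_le.2 hcover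
  · refine le_trans ?_ (Dynamics.netEntropyEntourage_le_coverEntropy _ _
      (Metric.dist_mem_uniformity (by positivity : (0 : ℝ) < (4 * N : ℝ)⁻¹)))
    refine ExpGrowth.expGrowthSup_monotone fun n => ?_
    have hnet := (isDynNetIn_circleMul (N := N) n).card_le_netMaxcard
    rw [card_circleTorsion] at hnet
    exact le_of_eq_of_le (by push_cast; rfl) (ENat.toENNReal_le.2 hnet)

end CircleMul

section CircleDigit

variable {N : ℕ}

theorem periodic_floor_natCast_mul (N : ℕ) :
    Function.Periodic (fun t : ℝ => (⌊N * t⌋ : ZMod N)) 1 := fun t => by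
  simp only [mul_add, mul_one, Int.floor_add_natCast, Int.cast_add, Int.cast_natCast,
    ZMod.natCast_self, add_zero]

/-- The first base `N` digit of a point of the circle, read modulo `N`. -/
noncomputable def circleDigit (N : ℕ) : UnitAddCircle → ZMod N :=
  (periodic_floor_natCast_mul N).lift

theorem circleDigit_coe (t : ℝ) : circleDigit N (t : UnitAddCircle) = ⌊N * t⌋ :=
  (periodic_floor_natCast_mul N).lift_coe t

theorem measurable_circleDigit : Measurable (circleDigit N) := by
  have hfloor : Measurable fun t : ℝ => (⌊N * t⌋ : ZMod N) :=
    (measurable_from_top (f := ((↑) : ℤ → ZMod N))).comp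
      (Int.measurable_floor.comp (measurable_const_mul _))
  have hrep : circleDigit N =
      (fun t : ℝ => (⌊N * t⌋ : ZMod N)) ∘ fun x => (AddCircle.measurableEquivIco 1 0 x : ℝ) := by
    funext x
    rw [Function.comp_apply, ← circleDigit_coe]
    exact congrArg _ AddCircle.coe_equivIco.symm
  rw [hrep]
  exact hfloor.comp (measurable_subtype_coe.comp (AddCircle.measurableEquivIco 1 0).measurable)

theorem floor_pow_mul_eq_of_circleDigit_eq [NeZero N] {s t : ℝ} (hs : ⌊s⌋ = ⌊t⌋)
    (h : ∀ n, circleDigit N ((circleMul N)^[n] s) = circleDigit N ((circleMul N)^[n] t)) (n : ℕ) :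
    ⌊N ^ n * s⌋ = ⌊N ^ n * t⌋ := by
  induction n with
  | zero => simpa using hs
  | succ n ih =>
    have hdigit := h n
    simp only [circleMul_iterate_apply, ← AddCircle.coe_nsmul, nsmul_eq_mul, circleDigit_coe,
      ZMod.intCast_eq_intCast_iff, Nat.cast_pow, ← mul_assoc, ← pow_succ'] at hdigit
    have hquot (r : ℝ) : ⌊N ^ (n + 1) * r⌋ / (N : ℤ) = ⌊N ^ n * r⌋ := by
      rw [pow_succ', mul_assoc, Int.natCast_mul_floor_div_cancel (NeZero.ne N)]
    rw [← Int.ediv_mul_add_emod ⌊N ^ (n + 1) * s⌋ N, ← Int.ediv_mul_add_emod ⌊N ^ (n + 1) * t⌋ N,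
      hquot, hquot, ih, hdigit]

theorem isGenerator_circleDigit [NeZero N] (hN : 1 < N) :
    IsGenerator (circleMul N) (circleDigit N) := by
  refine isGenerator_of_injective measurable_circleMul measurable_circleDigit fun x y hxy => ?_
  obtain ⟨s, hs, rfl⟩ := AddCircle.eq_coe_Ico x
  obtain ⟨t, ht, rfl⟩ := AddCircle.eq_coe_Ico y
  have hfloor := floor_pow_mul_eq_of_circleDigit_eq
    ((Int.floor_eq_zero_iff.2 hs).trans (Int.floor_eq_zero_iff.2 ht).symm) (congrFun hxy)
  have hclose (n : ℕ) : (N : ℝ) ^ n * |s - t| < 1 := by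
    rw [← abs_of_nonneg (by positivity : (0 : ℝ) ≤ N ^ n), ← abs_mul, mul_sub]
    exact Int.abs_sub_lt_one_of_floor_eq_floor (hfloor n)
  congr 1
  by_contra hne
  obtain ⟨n, hn⟩ := pow_unbounded_of_one_lt |s - t|⁻¹ (by exact_mod_cast hN : (1 : ℝ) < N)
  exact (hclose n).not_gt ((inv_lt_iff_one_lt_mul₀ (abs_pos.2 (sub_ne_zero.2 hne))).1 hn)

theorem measurePreserving_circleMul (hN : 1 < N) :
    MeasurePreserving (circleMul N) (volume : Measure UnitAddCircle) volume :=
  (AddCircle.ergodic_nsmul (T := 1) hN).toMeasurePreserving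

variable [NeZero N]

theorem circleDigit_add_toAddCircle (x : UnitAddCircle) (j : ZMod N) :
    circleDigit N (x + ZMod.toAddCircle j) = circleDigit N x + j := by
  obtain ⟨t, rfl⟩ := QuotientAddGroup.mk_surjective x
  obtain ⟨k, rfl⟩ := ZMod.intCast_surjective j
  rw [ZMod.toAddCircle_intCast, ← AddCircle.coe_add, circleDigit_coe,
    circleDigit_coe, mul_add, mul_div_cancel₀ _ (NeZero.ne (N : ℝ)), Int.floor_add_intCast,
    Int.cast_add]

theorem circleMul_add_toAddCircle (x : UnitAddCircle) (j : ZMod N) :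
    circleMul N (x + ZMod.toAddCircle j) = circleMul N x := by
  rw [circleMul, nsmul_add, ← map_nsmul, nsmul_eq_mul, ZMod.natCast_self, zero_mul, map_zero,
    add_zero, circleMul]

theorem volume_preimage_circleMul_inter_preimage_circleDigit (hN : 1 < N) {E : Set UnitAddCircle}
    (hE : MeasurableSet E) (i : ZMod N) :
    volume.real (circleMul N ⁻¹' E ∩ circleDigit N ⁻¹' {i}) = (N : ℝ)⁻¹ * volume.real E := by
  have hshift j : volume.real (circleDigit N ⁻¹' {j} ∩ circleMul N ⁻¹' E) =
      volume.real (circleDigit N ⁻¹' {i} ∩ circleMul N ⁻¹' E) := by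
    rw [← (measurePreserving_add_right volume (ZMod.toAddCircle (j - i))).measureReal_preimage
      ((measurable_circleDigit (measurableSet_singleton j)).inter
        (measurable_circleMul hE)).nullMeasurableSet]
    congr 1
    ext x
    rw [Set.mem_preimage, Set.mem_inter_iff, Set.mem_inter_iff, Set.mem_preimage,
      Set.mem_preimage, Set.mem_preimage, Set.mem_preimage, circleMul_add_toAddCircle,
      circleDigit_add_toAddCircle, Set.mem_singleton_iff, Set.mem_singleton_iff,
      ← eq_sub_iff_add_eq, sub_sub_cancel]
  have hsum := sum_measureReal_preimage_singleton_inter (μ := volume)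
    (measurable_circleDigit (N := N)) Finset.univ (circleMul N ⁻¹' E)
  simp only [hshift, Finset.sum_const, Finset.card_univ, ZMod.card, nsmul_eq_mul,
    Finset.coe_univ, Set.preimage_univ, Set.univ_inter] at hsum
  rw [(measurePreserving_circleMul hN).measureReal_preimage hE.nullMeasurableSet] at hsum
  rw [Set.inter_comm, ← hsum, inv_mul_cancel_left₀ (NeZero.ne (N : ℝ))]

instance isProbabilityMeasure_volume_unitAddCircle :
    IsProbabilityMeasure (volume : Measure UnitAddCircle) :=
  ⟨UnitAddCircle.measure_univ⟩

theorem volume_preimage_itinerary_circleDigit (hN : 1 < N) (n : ℕ) (w : Fin n → ZMod N) :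
    volume.real (itinerary (circleMul N) (circleDigit N) n ⁻¹' {w}) = ((N : ℝ) ^ n)⁻¹ := by
  induction n with
  | zero => rw [preimage_itinerary_zero, probReal_univ, pow_zero, inv_one]
  | succ n ih =>
    rw [preimage_itinerary_succ, volume_preimage_circleMul_inter_preimage_circleDigit hN
      (measurable_itinerary measurable_circleMul measurable_circleDigit n
        (measurableSet_singleton _)), ih, pow_succ', mul_inv]

theorem isMME_circleMul_iff (hN : 1 < N) {μ : Measure UnitAddCircle} :
    IsMME (circleMul N) μ ↔ μ = volume := by
  have hgen := isGenerator_circleDigit hN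
  have hmax {μ : Measure UnitAddCircle} [IsProbabilityMeasure μ]
      (hinv : MeasurePreserving (circleMul N) μ μ) :
      measureEntropy (circleMul N) μ = (log N : ℝ) ↔
        ∀ n w, μ.real (itinerary (circleMul N) (circleDigit N) n ⁻¹' {w}) = ((N : ℝ) ^ n)⁻¹ := by
    simpa only [ZMod.card] using hgen.measureEntropy_eq_log_card_iff hinv measurable_circleDigit
  rw [← coverEntropy_circleMul hN] at hmax
  constructor
  · rintro ⟨hprob, hinv, hent⟩
    exact hgen.measure_eq measurable_circleMul measurable_circleDigit fun n w => by
      rw [(hmax hinv).1 hent, volume_preimage_itinerary_circleDigit hN]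
  · rintro rfl
    exact ⟨inferInstance, measurePreserving_circleMul hN,
      (hmax (measurePreserving_circleMul hN)).2 (volume_preimage_itinerary_circleDigit hN)⟩

theorem volume_preimage_image_circleMul {E : Set UnitAddCircle} (hE : volume E = 0) :
    volume (circleMul N ⁻¹' (circleMul N '' E)) = 0 := by
  have hfin := AddCircle.finite_torsion (p := (1 : ℝ)) (NeZero.pos N)
  have hsub : circleMul N ⁻¹' (circleMul N '' E) ⊆
      ⋃ c ∈ {c : UnitAddCircle | N • c = 0}, (· + c) ⁻¹' E := by
    rintro x ⟨y, hy, hyx⟩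
    refine Set.mem_biUnion (x := y - x) ?_ ?_
    · rw [Set.mem_ofPred_eq, nsmul_sub, sub_eq_zero]
      exact hyx
    · rwa [Set.mem_preimage, add_sub_cancel]
  refine measure_mono_null hsub ((measure_biUnion_null_iff hfin.countable).2 fun c _ => ?_)
  rw [measure_preimage_add_right, hE]

end CircleDigit

section Factor

variable {X Y ι : Type*} {φ : X → Y} {S : X → X} {T : Y → Y}

theorem itinerary_comp_semiconj (h : Function.Semiconj φ S T) (ξ : Y → ι) (n : ℕ) :
    itinerary T ξ n ∘ φ = itinerary S (ξ ∘ φ) n := by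
  funext x i
  exact congrArg ξ ((h.iterate_right i).eq x).symm

variable [MeasurableSpace X] [MeasurableSpace Y]

theorem entropyOfPartition_map [Fintype ι] [MeasurableSpace ι] [MeasurableSingletonClass ι]
    (hφ : Measurable φ) (hT : Measurable T) (h : Function.Semiconj φ S T) (μ : Measure X)
    {ξ : Y → ι} (hξ : Measurable ξ) :
    entropyOfPartition T (μ.map φ) ξ = entropyOfPartition S μ (ξ ∘ φ) := by
  simp only [entropyOfPartition, partitionEntropy, ← itinerary_comp_semiconj h, Set.preimage_comp,
    map_measureReal_apply hφ (measurable_itinerary hT hξ _ (measurableSet_singleton _))]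

theorem measureEntropy_map_le (hφ : Measurable φ) (hT : Measurable T)
    (h : Function.Semiconj φ S T) (μ : Measure X) :
    measureEntropy T (μ.map φ) ≤ measureEntropy S μ :=
  iSup_le fun k => iSup₂_le fun ξ hξ => by
    rw [entropyOfPartition_map hφ hT h μ hξ]
    exact le_iSup₂_of_le k (ξ ∘ φ) (le_iSup_of_le (hξ.comp hφ) le_rfl)

theorem measureEntropy_map_measurableEquiv (φ : X ≃ᵐ Y) (hS : Measurable S) (hT : Measurable T)
    (h : Function.Semiconj φ S T) (μ : Measure X) :
    measureEntropy T (μ.map φ) = measureEntropy S μ := by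
  refine (measureEntropy_map_le φ.measurable hT h μ).antisymm ?_
  have hsymm := measureEntropy_map_le φ.symm.measurable hS
    (h.inverse_left φ.symm_apply_apply φ.apply_symm_apply) (μ.map φ)
  rwa [MeasurableEquiv.map_symm_map] at hsymm

end Factor

section TopologicalConjugacy

variable {X Y : Type*} [UniformSpace X] [CompactSpace X] [UniformSpace Y]
  {S : X → X} {T : Y → Y}

theorem coverEntropy_univ_le_of_semiconj {φ : X → Y} (hφ : Continuous φ)
    (hsurj : Function.Surjective φ) (h : Function.Semiconj φ S T) :
    Dynamics.coverEntropy T Set.univ ≤ Dynamics.coverEntropy S Set.univ := by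
  rw [← hsurj.range_eq, ← Set.image_univ]
  exact Dynamics.coverEntropy_image_le_of_uniformContinuous h
    (CompactSpace.uniformContinuous_of_continuous hφ) Set.univ

theorem IsMME.map_homeomorph [CompactSpace Y] [MeasurableSpace X] [BorelSpace X] [MeasurableSpace Y]
    [BorelSpace Y] (φ : X ≃ₜ Y) (h : Function.Semiconj φ S T) {μ : Measure X} (hμ : IsMME S μ) :
    IsMME T (μ.map φ) := by
  have := hμ.isProbabilityMeasure
  have hsymm := h.inverse_left φ.symm_apply_apply φ.apply_symm_apply
  have hS := hμ.measurePreserving.measurable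
  have hT : Measurable T := by
    have hT_eq : T = φ ∘ S ∘ φ.symm := by
      funext y
      rw [Function.comp_apply, Function.comp_apply, h.eq, φ.apply_symm_apply]
    rw [hT_eq]
    exact φ.measurable.comp (hS.comp φ.symm.measurable)
  refine ⟨Measure.isProbabilityMeasure_map φ.measurable.aemeasurable,
    φ.measurable.measurePreserving μ |>.of_semiconj hμ.measurePreserving h hT, ?_⟩
  calc measureEntropy T (μ.map φ) = measureEntropy S μ :=
        measureEntropy_map_measurableEquiv φ.toMeasurableEquiv hS hT h μ
    _ = Dynamics.coverEntropy S Set.univ := hμ.entropy_eq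
    _ = Dynamics.coverEntropy T Set.univ :=
        (coverEntropy_univ_le_of_semiconj φ.symm.continuous φ.symm.surjective hsymm).antisymm
          (coverEntropy_univ_le_of_semiconj φ.continuous φ.surjective h)

theorem isMME_iff_eq_map_homeomorph [CompactSpace Y] [MeasurableSpace X] [BorelSpace X]
    [MeasurableSpace Y] [BorelSpace Y] (φ : X ≃ₜ Y) (h : Function.Semiconj φ S T) {ν : Measure X}
    (hν : ∀ μ, IsMME S μ ↔ μ = ν) (μ : Measure Y) : IsMME T μ ↔ μ = ν.map φ := by
  refine ⟨fun hμ => ?_, ?_⟩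
  · rw [← (hν _).1 (hμ.map_homeomorph φ.symm
        (h.inverse_left φ.symm_apply_apply φ.apply_symm_apply))]
    exact (φ.toMeasurableEquiv.map_map_symm).symm
  · rintro rfl
    exact ((hν ν).2 rfl).map_homeomorph φ h

end TopologicalConjugacy

section ExpandingLift

variable {f : ℝ → ℝ} {N : ℕ}

theorem map_add_natCast_of_map_add_one (hdeg : ∀ x, f (x + 1) = f x + N) (x : ℝ) (m : ℕ) :
    f (x + m) = f x + N * m := by
  induction m with
  | zero => rw [Nat.cast_zero, add_zero, mul_zero, add_zero]
  | succ m ih => rw [Nat.cast_succ, ← add_assoc, hdeg, ih, mul_add_one, add_assoc]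

theorem iterate_map_add_one (hdeg : ∀ x, f (x + 1) = f x + N) (n : ℕ) (x : ℝ) :
    f^[n] (x + 1) = f^[n] x + (N ^ n : ℕ) := by
  induction n with
  | zero => rw [pow_zero, Nat.cast_one, Function.iterate_zero_apply, Function.iterate_zero_apply]
  | succ n ih =>
    rw [Function.iterate_succ_apply', ih, map_add_natCast_of_map_add_one hdeg, pow_succ',
      Nat.cast_mul, Function.iterate_succ_apply']

theorem exists_forall_abs_sub_mul_le (hf : Continuous f) (hdeg : ∀ x, f (x + 1) = f x + N) :
    ∃ K, ∀ x, |f x - N * x| ≤ K := by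
  have hper : Function.Periodic (fun x => f x - N * x) 1 := fun x => by
    simp only [hdeg, mul_add_one, add_sub_add_right_eq_sub]
  obtain ⟨K, hK⟩ := isBounded_iff_forall_norm_le.1
    (hper.isBounded_of_continuous one_ne_zero (by fun_prop))
  exact ⟨K, fun x => hK _ (Set.mem_range_self x)⟩

theorem exists_pos_forall_add_le_sub (hf : Continuous f) (hdeg : ∀ x, f (x + 1) = f x + N)
    (hexp : ∀ x y, x < y → y - x < f y - f x) {a : ℝ} (ha : 0 < a) (b : ℝ) :
    ∃ ε > 0, ∀ x, ∀ u ∈ Set.Icc a b, u + ε ≤ f (x + u) - f x := by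
  obtain ⟨ε, hε, hgap⟩ := ((isCompact_Icc (a := (0 : ℝ)) (b := 1)).prod
    (isCompact_Icc (a := a) (b := b))).exists_forall_le'
    (f := fun p : ℝ × ℝ => f (p.1 + p.2) - f p.1 - p.2) (by fun_prop) (a := 0) fun p hp => by
      have := hexp p.1 (p.1 + p.2) (lt_add_of_pos_right _ (ha.trans_le hp.2.1))
      linarith
  refine ⟨ε, hε, fun x u hu => ?_⟩
  have hper : Function.Periodic (fun x => f (x + u) - f x - u) 1 := fun x => by
    simp only [add_right_comm x, hdeg, add_sub_add_right_eq_sub]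
  obtain ⟨y, hy, hxy⟩ := hper.exists_mem_Ico₀ one_pos x
  have := hgap (y, u) ⟨Set.Ico_subset_Icc_self hy, hu⟩
  linarith

theorem exists_lt_iterate_sub_iterate (hf : Continuous f) (hdeg : ∀ x, f (x + 1) = f x + N)
    (hexp : ∀ x y, x < y → y - x < f y - f x) {x y : ℝ} (hxy : x < y) (B : ℝ) :
    ∃ n, B < f^[n] y - f^[n] x := by
  by_contra! hB
  obtain ⟨ε, hε, hgap⟩ := exists_pos_forall_add_le_sub hf hdeg hexp (sub_pos.2 hxy) B
  have hgrow (n : ℕ) : y - x + n * ε ≤ f^[n] y - f^[n] x := by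
    induction n with
    | zero => simp
    | succ n ih =>
      have hlower : y - x ≤ f^[n] y - f^[n] x := (le_add_of_nonneg_right (by positivity)).trans ih
      have hstep := hgap (f^[n] x) (f^[n] y - f^[n] x) ⟨hlower, hB n⟩
      rw [add_sub_cancel, ← Function.iterate_succ_apply' f, ← Function.iterate_succ_apply' f]
        at hstep
      push_cast
      linarith
  obtain ⟨n, hn⟩ := exists_nat_gt (B / ε)
  rw [div_lt_iff₀ hε] at hn
  linarith [hgrow n, hB n]

/-- The series `h x = x + ∑ (f (fⁿ x) - N fⁿ x) / Nⁿ⁺¹`, which telescopes to `lim fⁿ x / Nⁿ`. For a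
continuous map `f` of the line that lifts a circle map of degree `N > 1`, it is the semiconjugacy
from `f` to multiplication by `N`. -/
noncomputable def linearization (f : ℝ → ℝ) (N : ℕ) (x : ℝ) : ℝ :=
  x + ∑' n : ℕ, (f (f^[n] x) - N * f^[n] x) / (N : ℝ) ^ (n + 1)

theorem exists_summable_forall_norm_linearization_le (hN : 1 < N) (hf : Continuous f)
    (hdeg : ∀ x, f (x + 1) = f x + N) :
    ∃ u : ℕ → ℝ, Summable u ∧
      ∀ n x, ‖(f (f^[n] x) - N * f^[n] x) / (N : ℝ) ^ (n + 1)‖ ≤ u n := by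
  obtain ⟨K, hK⟩ := exists_forall_abs_sub_mul_le hf hdeg
  have hgeom : Summable fun n : ℕ => ((N : ℝ)⁻¹) ^ (n + 1) := (summable_nat_add_iff 1).2 <|
    summable_geometric_of_lt_one (by positivity) (inv_lt_one_of_one_lt₀ (by exact_mod_cast hN))
  refine ⟨_, hgeom.mul_left K, fun n x => ?_⟩
  rw [norm_div, norm_pow, norm_natCast, div_eq_mul_inv, inv_pow]
  gcongr
  exact hK _

theorem continuous_linearization (hN : 1 < N) (hf : Continuous f)
    (hdeg : ∀ x, f (x + 1) = f x + N) : Continuous (linearization f N) := by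
  obtain ⟨u, hu, hbound⟩ := exists_summable_forall_norm_linearization_le hN hf hdeg
  refine continuous_id.add (continuous_tsum (fun n => ?_) hu hbound)
  have := hf.iterate n
  fun_prop

theorem linearization_add_one (hdeg : ∀ x, f (x + 1) = f x + N) (x : ℝ) :
    linearization f N (x + 1) = linearization f N x + 1 := by
  simp only [linearization, iterate_map_add_one hdeg, map_add_natCast_of_map_add_one hdeg,
    mul_add, add_sub_add_right_eq_sub, add_right_comm]

theorem semiconj_linearization (hN : 1 < N) (hf : Continuous f)
    (hdeg : ∀ x, f (x + 1) = f x + N) :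
    Function.Semiconj (linearization f N) f (fun x => N * x) := fun x => by
  obtain ⟨u, hu, hbound⟩ := exists_summable_forall_norm_linearization_le hN hf hdeg
  have hN0 : (N : ℝ) ≠ 0 := by positivity
  have hshift (n : ℕ) : (N : ℝ) * ((f (f^[n + 1] x) - N * f^[n + 1] x) / (N : ℝ) ^ (n + 1 + 1)) =
      (f (f^[n] (f x)) - N * f^[n] (f x)) / (N : ℝ) ^ (n + 1) := by
    rw [Function.iterate_succ_apply, pow_succ' _ (n + 1), mul_div_assoc',
      mul_div_mul_left _ _ hN0]
  simp only [linearization]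
  rw [(hu.of_norm_bounded fun n => hbound n x).tsum_eq_zero_add, mul_add, mul_add, ← tsum_mul_left]
  simp only [hshift, Function.iterate_zero_apply, zero_add, pow_one]
  rw [mul_div_cancel₀ _ hN0, ← add_assoc, add_sub_cancel]

theorem strictMono_linearization (hN : 1 < N) (hf : Continuous f)
    (hdeg : ∀ x, f (x + 1) = f x + N) (hexp : ∀ x y, x < y → y - x < f y - f x) :
    StrictMono (linearization f N) := fun x y hxy => by
  obtain ⟨C, hC⟩ := exists_forall_abs_sub_mul_le (N := 1) (continuous_linearization hN hf hdeg)
    fun x => by rw [linearization_add_one hdeg, Nat.cast_one]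
  obtain ⟨n, hn⟩ := exists_lt_iterate_sub_iterate hf hdeg hexp hxy (2 * C)
  have hiter (z : ℝ) : linearization f N (f^[n] z) = N ^ n * linearization f N z := by
    rw [((semiconj_linearization hN hf hdeg).iterate_right n).eq, mul_left_iterate]
  have hx := abs_le.1 (hC (f^[n] x))
  have hy := abs_le.1 (hC (f^[n] y))
  rw [hiter, Nat.cast_one, one_mul] at hx hy
  exact lt_of_mul_lt_mul_left (by linarith : (N : ℝ) ^ n * linearization f N x <
    N ^ n * linearization f N y) (by positivity)

theorem exists_homeomorph_unitAddCircle_coe (g : CircleDeg1Lift) (hg : Continuous g)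
    (hinj : Function.Injective g) :
    ∃ Φ : UnitAddCircle ≃ₜ UnitAddCircle, ∀ x : ℝ, Φ x = (g x : UnitAddCircle) := by
  have hper : Function.Periodic (fun x => (g x : UnitAddCircle)) 1 := fun x => by
    simp only [g.map_add_one, AddCircle.coe_add, AddCircle.coe_period, add_zero]
  have hcont : Continuous hper.lift := (QuotientAddGroup.isQuotientMap_mk _).continuous_iff.2
    ((AddCircle.continuous_mk' 1).comp hg)
  have hbij : Function.Bijective hper.lift := by
    constructor
    · intro a b hab
      obtain ⟨x, rfl⟩ := QuotientAddGroup.mk_surjective a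
      obtain ⟨y, rfl⟩ := QuotientAddGroup.mk_surjective b
      have hab' : ((g x - g y : ℝ) : UnitAddCircle) = 0 := by
        rw [AddCircle.coe_sub]
        exact sub_eq_zero.2 hab
      obtain ⟨m, hm⟩ := (AddCircle.coe_eq_zero_iff 1).1 hab'
      rw [zsmul_one, eq_sub_iff_add_eq', ← g.map_add_int] at hm
      exact sub_eq_zero.1 ((AddCircle.coe_eq_zero_iff 1).2
        ⟨m, by rw [zsmul_one, ← hinj hm]; exact (add_sub_cancel_left _ _).symm⟩)
    · intro b
      obtain ⟨y, rfl⟩ := QuotientAddGroup.mk_surjective b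
      obtain ⟨x, rfl⟩ := g.continuous_iff_surjective.1 hg y
      exact ⟨x, hper.lift_coe x⟩
  exact ⟨hcont.homeoOfEquivCompactToT2 (f := Equiv.ofBijective _ hbij), hper.lift_coe⟩

theorem exists_conjugacy_circleMul (hN : 1 < N) (hf : Continuous f)
    (hdeg : ∀ x, f (x + 1) = f x + N) (hexp : ∀ x y, x < y → y - x < f y - f x)
    {A : Circle → Circle} (hA : ∀ x, A (Circle.exp (2 * π * x)) = Circle.exp (2 * π * f x)) :
    ∃ Φ : UnitAddCircle ≃ₜ Circle, Function.Semiconj Φ (circleMul N) A := by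
  have hmono := strictMono_linearization hN hf hdeg hexp
  obtain ⟨Φ, hΦ⟩ := exists_homeomorph_unitAddCircle_coe
    ⟨⟨linearization f N, hmono.monotone⟩, linearization_add_one hdeg⟩
    (continuous_linearization hN hf hdeg) hmono.injective
  have hexpm (x : ℝ) : AddCircle.homeomorphCircle (T := 1) one_ne_zero x =
      Circle.exp (2 * π * x) := by
    rw [AddCircle.homeomorphCircle_apply, AddCircle.toCircle_apply_mk, div_one]
  refine ⟨Φ.symm.trans (AddCircle.homeomorphCircle one_ne_zero), fun a => ?_⟩
  obtain ⟨a, rfl⟩ := Φ.surjective a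
  obtain ⟨x, rfl⟩ := QuotientAddGroup.mk_surjective a
  have hΦf : circleMul N (Φ x) = Φ (f x) := by
    rw [hΦ, hΦ, circleMul_coe]
    exact congrArg _ ((semiconj_linearization hN hf hdeg).eq x).symm
  simp only [Homeomorph.trans_apply]
  rw [hΦf, Φ.symm_apply_apply, Φ.symm_apply_apply, hexpm, hexpm, hA]

end ExpandingLift

section BlaschkeLift

variable {a : ℝ}

/-- A lift to the line of the action on the unit circle of the Blaschke factor
`z ↦ (z - a) / (1 - a z)`, for `|a| < 1`. -/
noncomputable def blaschkeLift (a s : ℝ) : ℝ :=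
  s + 2 * arctan (a * sin s / (1 - a * cos s))

theorem one_sub_mul_cos_pos (ha : |a| < 1) (s : ℝ) : 0 < 1 - a * cos s := by
  have h : |a * cos s| < 1 := by
    rw [abs_mul]
    exact (mul_le_of_le_one_right (abs_nonneg a) (abs_cos_le_one s)).trans_lt ha
  exact sub_pos.2 (lt_of_abs_lt h)

theorem one_sub_two_mul_mul_cos_add_sq_pos (ha : |a| < 1) (s : ℝ) :
    0 < 1 - 2 * a * cos s + a ^ 2 := by
  have hpos := one_sub_mul_cos_pos ha s
  calc 0 < (1 - a * cos s) ^ 2 + (a * sin s) ^ 2 := by positivity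
    _ = 1 - 2 * a * cos s + a ^ 2 := by linear_combination a ^ 2 * sin_sq_add_cos_sq s

theorem hasDerivAt_blaschkeLift (ha : |a| < 1) (s : ℝ) :
    HasDerivAt (blaschkeLift a) ((1 - a ^ 2) / (1 - 2 * a * cos s + a ^ 2)) s := by
  have hpos := one_sub_mul_cos_pos ha s
  have hden := (one_sub_two_mul_mul_cos_add_sq_pos ha s).ne'
  have hquot := ((hasDerivAt_sin s).const_mul a).div
    (((hasDerivAt_cos s).const_mul a).const_sub 1) hpos.ne'
  refine ((hasDerivAt_id s).add (hquot.arctan.const_mul 2)).congr_deriv ?_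
  have hsq : 1 + (a * sin s / (1 - a * cos s)) ^ 2 =
      (1 - 2 * a * cos s + a ^ 2) / (1 - a * cos s) ^ 2 := by
    field_simp
    linear_combination a ^ 2 * sin_sq_add_cos_sq s
  rw [Pi.div_apply, hsq]
  field_simp
  linear_combination (-2 * a ^ 2) * sin_sq_add_cos_sq s

theorem continuous_blaschkeLift (ha : |a| < 1) : Continuous (blaschkeLift a) :=
  continuous_iff_continuousAt.2 fun s => (hasDerivAt_blaschkeLift ha s).continuousAt

theorem strictMono_blaschkeLift (ha : |a| < 1) : StrictMono (blaschkeLift a) :=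
  strictMono_of_deriv_pos fun s => by
    rw [(hasDerivAt_blaschkeLift ha s).deriv]
    exact div_pos (sub_pos.2 ((sq_lt_one_iff_abs_lt_one a).2 ha))
      (one_sub_two_mul_mul_cos_add_sq_pos ha s)

theorem blaschkeLift_add_two_pi (a s : ℝ) :
    blaschkeLift a (s + 2 * π) = blaschkeLift a s + 2 * π := by
  rw [blaschkeLift, blaschkeLift, sin_add_two_pi, cos_add_two_pi, add_right_comm]

theorem blaschkeLift_neg (a s : ℝ) : blaschkeLift a (-s) = -blaschkeLift a s := by
  rw [blaschkeLift, blaschkeLift, sin_neg, cos_neg, mul_neg, neg_div, arctan_neg, mul_neg, neg_add]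

theorem blaschkeLift_cos_self {α : ℝ} (h₀ : 0 < α) (hα : α < π) :
    blaschkeLift (cos α) α = π - α := by
  have hsin : sin α ≠ 0 := (sin_pos_of_pos_of_lt_pi h₀ hα).ne'
  have htan : cos α * sin α / (1 - cos α * cos α) = tan (π / 2 - α) := by
    rw [tan_eq_sin_div_cos, sin_pi_div_two_sub, cos_pi_div_two_sub, ← sq (cos α), ← sin_sq]
    field_simp
  rw [blaschkeLift, htan, arctan_tan (by linarith) (by linarith)]
  ring

theorem strictMonoOn_blaschkeLift_sub_id {α : ℝ} (h₀ : 0 < α) (hα : α < π / 2) :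
    StrictMonoOn (fun s => blaschkeLift (cos α) s - s) (Set.Icc (-α) α) := by
  have hα_pi : α < π := hα.trans (half_lt_self pi_pos)
  have hcos₀ : 0 < cos α := cos_pos_of_mem_Ioo ⟨by linarith, hα⟩
  have hcos : |cos α| < 1 := by
    rw [abs_of_pos hcos₀, ← cos_zero]
    exact cos_lt_cos_of_nonneg_of_le_pi le_rfl hα_pi.le h₀
  refine strictMonoOn_of_deriv_pos (convex_Icc _ _)
    ((continuous_blaschkeLift hcos).sub continuous_id).continuousOn fun s hs => ?_
  rw [interior_Icc] at hs
  have hcos_lt : cos α < cos s := by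
    rw [← cos_abs s]
    exact cos_lt_cos_of_nonneg_of_le_pi (abs_nonneg s) hα_pi.le (abs_lt.2 hs)
  have hderiv : deriv (fun s => blaschkeLift (cos α) s - s) s =
      (1 - cos α ^ 2) / (1 - 2 * cos α * cos s + cos α ^ 2) - 1 :=
    ((hasDerivAt_blaschkeLift hcos s).sub (hasDerivAt_id s)).deriv
  rw [hderiv, sub_pos, one_lt_div (one_sub_two_mul_mul_cos_add_sq_pos hcos s)]
  linarith [mul_pos hcos₀ (sub_pos.2 hcos_lt)]

theorem circleExp_two_mul_arctan (t : ℝ) :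
    (Circle.exp (2 * arctan t) : ℂ) = (1 + t * Complex.I) / (1 - t * Complex.I) := by
  have hexp (t : ℝ) : (Circle.exp (arctan t) : ℂ) = (1 + t * Complex.I) / √(1 + t ^ 2) := by
    rw [Circle.coe_exp, Complex.exp_mul_I, ← Complex.ofReal_cos, ← Complex.ofReal_sin, cos_arctan,
      sin_arctan]
    push_cast
    ring
  have hsqrt : (√(1 + t ^ 2) : ℂ) ≠ 0 := Complex.ofReal_ne_zero.2 (by positivity)
  calc (Circle.exp (2 * arctan t) : ℂ)
      = Circle.exp (arctan t) / Circle.exp (arctan (-t)) := by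
        rw [← Circle.coe_div, ← Circle.exp_sub, arctan_neg, sub_neg_eq_add, two_mul]
    _ = (1 + t * Complex.I) / (1 - t * Complex.I) := by
        rw [hexp, hexp, neg_sq, div_div_div_cancel_right₀ hsqrt, Complex.ofReal_neg, neg_mul,
          ← sub_eq_add_neg]

theorem circleExp_blaschkeLift (ha : |a| < 1) (s : ℝ) :
    (Circle.exp (blaschkeLift a s) : ℂ) = (Circle.exp s - a) / (1 - a * Circle.exp s) := by
  have hden : (1 - a * cos s : ℂ) ≠ 0 := by exact_mod_cast (one_sub_mul_cos_pos ha s).ne'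
  have hexp : (Circle.exp s : ℂ) = cos s + sin s * Complex.I := by
    rw [Circle.coe_exp, Complex.exp_mul_I, ← Complex.ofReal_cos, ← Complex.ofReal_sin]
  have hsq : (sin s : ℂ) ^ 2 + (cos s : ℂ) ^ 2 = 1 := by exact_mod_cast sin_sq_add_cos_sq s
  calc (Circle.exp (blaschkeLift a s) : ℂ)
      = Circle.exp s * ((1 + (a * sin s / (1 - a * cos s) : ℝ) * Complex.I) /
          (1 - (a * sin s / (1 - a * cos s) : ℝ) * Complex.I)) := by
        rw [blaschkeLift, Circle.exp_add, Circle.coe_mul, circleExp_two_mul_arctan]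
    _ = Circle.exp s * ((1 - a * cos s + a * sin s * Complex.I) /
          (1 - a * cos s - a * sin s * Complex.I)) := by
        rw [← mul_div_mul_left _ (1 - _ * Complex.I) hden]
        simp only [Complex.ofReal_div, Complex.ofReal_mul, Complex.ofReal_sub, Complex.ofReal_one]
        congr 2 <;> field_simp
    _ = (Circle.exp s - a) / (1 - a * Circle.exp s) := by
        rw [← mul_div_assoc, hexp]
        congr 1
        · linear_combination (-a : ℂ) * hsq + (a * (sin s : ℂ) ^ 2) * Complex.I_sq
        · ring

theorem coe_hypReflection {c : ℂ} {r : ℝ} (hr : r ≠ 0) (h : ‖c‖ ^ 2 = 1 + r ^ 2) (z : Circle) :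
    (hypReflection c r hr h z : ℂ) = (c - z) / (1 - starRingEnd ℂ c * z) := by
  have hzz : (z : ℂ) * starRingEnd ℂ z = 1 := by
    rw [Complex.mul_conj, Circle.normSq_coe, Complex.ofReal_one]
  have hcc : c * starRingEnd ℂ c = 1 + r ^ 2 := by
    rw [Complex.mul_conj, Complex.normSq_eq_norm_sq, h, Complex.ofReal_add, Complex.ofReal_one,
      Complex.ofReal_pow]
  have hzc : (z : ℂ) - c ≠ 0 := fun hzc => by
    rw [← sub_eq_zero.1 hzc, Circle.norm_coe] at h
    exact hr (pow_eq_zero_iff two_ne_zero |>.1 (by linarith))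
  have hzc' : starRingEnd ℂ (z - c) ≠ 0 := (map_ne_zero _).2 hzc
  have hden : 1 - starRingEnd ℂ c * z = z * starRingEnd ℂ (z - c) := by
    rw [map_sub]
    linear_combination -hzz
  calc (hypReflection c r hr h z : ℂ)
      = r ^ 2 / ((z - c) * starRingEnd ℂ (z - c)) * (z - c) + c := by
        rw [Complex.mul_conj, Complex.normSq_eq_norm_sq]
        change EuclideanGeometry.inversion c r (z : ℂ) = _
        simp only [EuclideanGeometry.inversion, dist_eq_norm, div_pow, vsub_eq_sub, vadd_eq_add,
          Complex.real_smul, Complex.ofReal_div, Complex.ofReal_pow]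
    _ = (c - z) / (z * starRingEnd ℂ (z - c)) := by
        have hz : (z : ℂ) ≠ 0 := z.coe_ne_zero
        field_simp
        rw [map_sub]
        linear_combination c * hzz - z * hcc
    _ = (c - z) / (1 - starRingEnd ℂ c * z) := by rw [hden]

theorem hypReflection_exp_add {c : ℂ} {r : ℝ} (hr : r ≠ 0) (h : ‖c‖ ^ 2 = 1 + r ^ 2)
    (ha₀ : a ≠ 0) (ha : |a| < 1) {u : ℝ} (hc : c = (a⁻¹ : ℝ) * (Circle.exp u : ℂ)) (s : ℝ) :
    hypReflection c r hr h (Circle.exp (u + s)) = Circle.exp (u - π - blaschkeLift a s) := by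
  have ha₀' : (a : ℂ) ≠ 0 := Complex.ofReal_ne_zero.2 ha₀
  have hee : starRingEnd ℂ (Circle.exp u : ℂ) * Circle.exp u = 1 := by
    rw [mul_comm, Complex.mul_conj, Circle.normSq_coe, Complex.ofReal_one]
  apply Circle.ext
  calc (hypReflection c r hr h (Circle.exp (u + s)) : ℂ)
      = ((a : ℂ)⁻¹ * Circle.exp u - Circle.exp u * Circle.exp s) /
          (1 - (a : ℂ)⁻¹ * (starRingEnd ℂ (Circle.exp u) * Circle.exp u) * Circle.exp s) := by
        rw [coe_hypReflection, hc, Circle.exp_add, Circle.coe_mul, map_mul, Complex.conj_ofReal,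
          Complex.ofReal_inv]
        ring_nf
    _ = -(Circle.exp u / ((Circle.exp s - a) / (1 - a * Circle.exp s))) := by
        rw [hee, mul_one, ← mul_div_mul_left _ _ ha₀', div_div_eq_mul_div, ← neg_div_neg_eq,
          ← neg_div]
        congr 1 <;> field_simp
        ring
    _ = (Circle.exp (u - π - blaschkeLift a s) : ℂ) := by
        rw [Circle.exp_sub, Circle.exp_sub, Circle.coe_div, Circle.coe_div,
          circleExp_blaschkeLift ha, Circle.coe_exp π, Complex.exp_pi_mul_I, div_neg, div_one,
          neg_div]

end BlaschkeLift

section PreferredDomain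

variable {d : ℕ}

/-- Half the length of the arc of the circle subtended by a side of the preferred domain. -/
noncomputable def sideHalfAngle (d : ℕ) : ℝ := π / (2 * d)

/-- The argument of the midpoint of the arc subtended by side `k` of the preferred domain. The index
ranges over the integers, which lets the sides be followed along the universal cover. -/
noncomputable def sideMid (d : ℕ) (k : ℤ) : ℝ := sideHalfAngle d * (2 * k + 1)

/-- The index of the side subtending the arc around `x`, on the universal cover of the circle. -/
noncomputable def sideIndex (d : ℕ) (x : ℝ) : ℤ := ⌊x / (2 * sideHalfAngle d)⌋

/-- The common lift of the side pairings of the preferred domain, in the coordinate on the source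
that is centred at the midpoint of the arc of the side, and up to a rotation of the target. -/
noncomputable def sideLift (d : ℕ) : ℝ → ℝ := blaschkeLift (cos (sideHalfAngle d))

theorem sideHalfAngle_pos (hd : 2 ≤ d) : 0 < sideHalfAngle d := (sideAngle_mem hd).1

theorem sideHalfAngle_lt_pi_div_two (hd : 2 ≤ d) : sideHalfAngle d < π / 2 := (sideAngle_mem hd).2

theorem two_mul_mul_sideHalfAngle (hd : 2 ≤ d) : 2 * d * sideHalfAngle d = π := by
  rw [sideHalfAngle]
  field_simp

theorem cos_sideHalfAngle_pos (hd : 2 ≤ d) : 0 < cos (sideHalfAngle d) :=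
  cos_pos_of_mem_Ioo
    ⟨by linarith [sideHalfAngle_pos hd, pi_pos], sideHalfAngle_lt_pi_div_two hd⟩

theorem abs_cos_sideHalfAngle_lt_one (hd : 2 ≤ d) : |cos (sideHalfAngle d)| < 1 := by
  rw [abs_of_pos (cos_sideHalfAngle_pos hd), ← cos_zero]
  exact cos_lt_cos_of_nonneg_of_le_pi_div_two le_rfl (sideHalfAngle_lt_pi_div_two hd).le
    (sideHalfAngle_pos hd)

theorem sideMid_add_mul (hd : 2 ≤ d) (k m : ℤ) :
    sideMid d (k + (2 * d : ℕ) * m) = sideMid d k + m * (2 * π) := by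
  rw [sideMid, sideMid]
  push_cast
  linear_combination 2 * m * two_mul_mul_sideHalfAngle hd

theorem sideMid_rev (hd : 2 ≤ d) (k : Fin (2 * d)) :
    sideMid d (Fin.rev k : ℕ) = 2 * π - sideMid d (k : ℕ) := by
  rw [sideMid, sideMid, Fin.val_rev, Nat.cast_sub (by omega)]
  push_cast
  linear_combination 2 * two_mul_mul_sideHalfAngle hd

theorem sideIndex_eq_iff (hd : 2 ≤ d) {x : ℝ} {k : ℤ} :
    sideIndex d x = k ↔
      x - sideMid d k ∈ Set.Ico (-sideHalfAngle d) (sideHalfAngle d) := by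
  have hα : 0 < 2 * sideHalfAngle d := by linarith [sideHalfAngle_pos hd]
  rw [sideIndex, Int.floor_eq_iff, le_div_iff₀ hα, div_lt_iff₀ hα, sideMid, Set.mem_Ico]
  constructor <;> rintro ⟨h₁, h₂⟩ <;> constructor <;> linarith

theorem sideIndex_add_two_pi (hd : 2 ≤ d) (x : ℝ) :
    sideIndex d (x + 2 * π) = sideIndex d x + (2 * d : ℕ) * 1 := by
  rw [sideIndex_eq_iff hd, sideMid_add_mul hd, Int.cast_one, one_mul, add_sub_add_right_eq_sub]
  exact (sideIndex_eq_iff hd).1 rfl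

theorem sideLift_add_two_pi (d : ℕ) (s : ℝ) : sideLift d (s + 2 * π) = sideLift d s + 2 * π :=
  blaschkeLift_add_two_pi _ s

theorem sideLift_sideHalfAngle (hd : 2 ≤ d) : sideLift d (sideHalfAngle d) = π - sideHalfAngle d :=
  blaschkeLift_cos_self (sideHalfAngle_pos hd)
    (by linarith [sideHalfAngle_lt_pi_div_two hd, pi_pos])

theorem sideLift_neg_sideHalfAngle (hd : 2 ≤ d) :
    sideLift d (-sideHalfAngle d) = sideHalfAngle d - π := by
  rw [sideLift, blaschkeLift_neg, ← sideLift, sideLift_sideHalfAngle hd, neg_sub]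

theorem continuous_sideLift (hd : 2 ≤ d) : Continuous (sideLift d) :=
  continuous_blaschkeLift (abs_cos_sideHalfAngle_lt_one hd)

theorem strictMono_sideLift (hd : 2 ≤ d) : StrictMono (sideLift d) :=
  strictMono_blaschkeLift (abs_cos_sideHalfAngle_lt_one hd)

theorem strictMonoOn_sideLift_sub_id (hd : 2 ≤ d) :
    StrictMonoOn (fun s => sideLift d s - s) (Set.Icc (-sideHalfAngle d) (sideHalfAngle d)) :=
  strictMonoOn_blaschkeLift_sub_id (sideHalfAngle_pos hd) (sideHalfAngle_lt_pi_div_two hd)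

theorem hypReflection_sideCenter_exp (hd : 2 ≤ d) (j : Fin d) (s : ℝ) :
    hypReflection (sideCenter d j) (sideRadius d) (sideRadius_ne_zero hd)
      (norm_sideCenter_sq hd j) (Circle.exp (sideMid d (j : ℕ) + s)) =
        Circle.exp (sideMid d (j : ℕ) - π - sideLift d s) := by
  refine hypReflection_exp_add _ _ (cos_sideHalfAngle_pos hd).ne' (abs_cos_sideHalfAngle_lt_one hd)
    ?_ s
  rw [sideCenter, sideMid, sideHalfAngle, Int.cast_natCast, mul_div_right_comm]

theorem sideGenerator_exp (hd : 2 ≤ d) (j : Fin d) (s : ℝ) :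
    sideGenerator hd j (Circle.exp (sideMid d (j : ℕ) + s)) =
      Circle.exp (π - sideMid d (j : ℕ) + sideLift d s) := by
  change (hypReflection _ _ _ _ _)⁻¹ = _
  rw [hypReflection_sideCenter_exp hd, ← Circle.exp_neg]
  ring_nf

theorem sideGenerator_inv_exp (hd : 2 ≤ d) (j : Fin d) (s : ℝ) :
    (sideGenerator hd j)⁻¹ (Circle.exp (-sideMid d (j : ℕ) + s)) =
      Circle.exp (π + sideMid d (j : ℕ) + sideLift d s) := by
  change hypReflection (sideCenter d j) (sideRadius d) (sideRadius_ne_zero hd)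
    (norm_sideCenter_sq hd j) (Circle.exp (-sideMid d (j : ℕ) + s))⁻¹ = _
  rw [← Circle.exp_neg, neg_add, neg_neg, hypReflection_sideCenter_exp hd, sideLift,
    blaschkeLift_neg, Circle.exp_eq_exp]
  exact ⟨-1, by push_cast; ring⟩

theorem pairing_castLE (hd : 2 ≤ d) (j : Fin d) :
    (preferredDomain hd).pairing (Fin.castLE (Nat.le_mul_of_pos_left d two_pos) j) =
      sideGenerator hd j :=
  dif_pos j.2

theorem pairing_rev_castLE (hd : 2 ≤ d) (j : Fin d) :
    (preferredDomain hd).pairing (Fin.castLE (Nat.le_mul_of_pos_left d two_pos) j).rev =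
      (sideGenerator hd j)⁻¹ := by
  have hval : ((Fin.castLE (Nat.le_mul_of_pos_left d two_pos) j).rev : ℕ) = 2 * d - (j + 1) :=
    Fin.val_rev _
  refine (dif_neg (by omega)).trans (congrArg (fun j => (sideGenerator hd j)⁻¹) (Fin.ext ?_))
  change 2 * d - 1 - _ = (j : ℕ)
  omega

theorem exists_eq_castLE_or_eq_rev_castLE (k : Fin (2 * d)) :
    ∃ j : Fin d, k = Fin.castLE (Nat.le_mul_of_pos_left d two_pos) j ∨
      k = (Fin.castLE (Nat.le_mul_of_pos_left d two_pos) j).rev := by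
  rcases lt_or_ge (k : ℕ) d with hk | hk
  · exact ⟨⟨k, hk⟩, Or.inl rfl⟩
  · exact ⟨⟨2 * d - (k + 1), by omega⟩, Or.inr (Fin.rev_rev k).symm⟩

theorem pairing_rev (hd : 2 ≤ d) (k : Fin (2 * d)) :
    (preferredDomain hd).pairing k.rev = ((preferredDomain hd).pairing k)⁻¹ := by
  obtain ⟨j, rfl | rfl⟩ := exists_eq_castLE_or_eq_rev_castLE k
  · rw [pairing_rev_castLE, pairing_castLE]
  · rw [pairing_rev_castLE, Fin.rev_rev, pairing_castLE, inv_inv]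

theorem pairing_exp (hd : 2 ≤ d) (k : Fin (2 * d)) (s : ℝ) :
    (preferredDomain hd).pairing k (Circle.exp (sideMid d (k : ℕ) + s)) =
      Circle.exp (π - sideMid d (k : ℕ) + sideLift d s) := by
  obtain ⟨j, rfl | rfl⟩ := exists_eq_castLE_or_eq_rev_castLE k
  · rw [pairing_castLE]
    exact sideGenerator_exp hd j s
  · rw [pairing_rev_castLE, sideMid_rev hd]
    have hsource : Circle.exp (2 * π - sideMid d (j : ℕ) + s) =
        Circle.exp (-sideMid d (j : ℕ) + s) := Circle.exp_eq_exp.2 ⟨1, by push_cast; ring⟩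
    refine (congrArg _ hsource).trans ((sideGenerator_inv_exp hd j s).trans ?_)
    exact Circle.exp_eq_exp.2 ⟨1, by push_cast [Fin.val_castLE]; ring⟩

theorem puncturedSphereGroup_induction (hd : 2 ≤ d) {p : (Circle ≃ₜ Circle) → Prop}
    (pairing : ∀ k, p ((preferredDomain hd).pairing k)) (one : p 1)
    (mul : ∀ γ₁ γ₂, p γ₁ → p γ₂ → p (γ₁ * γ₂)) {γ : Circle ≃ₜ Circle}
    (hγ : γ ∈ puncturedSphereGroup hd) : p γ := by
  induction hγ using Subgroup.closure_induction'' with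
  | mem γ hγ =>
    obtain ⟨j, rfl⟩ := hγ
    exact pairing_castLE hd j ▸ pairing _
  | inv_mem γ hγ =>
    obtain ⟨j, rfl⟩ := hγ
    exact pairing_rev_castLE hd j ▸ pairing _
  | one => exact one
  | mul γ₁ γ₂ _ _ h₁ h₂ => exact mul γ₁ γ₂ h₁ h₂

end PreferredDomain

section IdealPolygon

variable {n : ℕ} {R : MarkedIdealPolygon n}

/-- The half-open arc of the circle subtended by side `i` of an ideal polygon. -/
def MarkedIdealPolygon.arc (R : MarkedIdealPolygon n) (i : Fin n) : Set Circle :=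
  ccwArc (R.vertex i) (R.vertex (finRotate n i))

theorem MarkedIdealPolygon.bowenSeriesMap_of_mem_arc (hR : Pairwise (Function.onFun Disjoint R.arc))
    {i : Fin n} {z : Circle} (hz : z ∈ R.arc i) : R.bowenSeriesMap z = R.pairing i z := by
  have h : ∃ i, z ∈ ccwArc (R.vertex i) (R.vertex (finRotate n i)) := ⟨i, hz⟩
  rw [bowenSeriesMap, dif_pos h, hR.eq (Set.not_disjoint_iff.2 ⟨z, h.choose_spec, hz⟩)]

theorem MarkedIdealPolygon.bowenSeriesMap_of_forall_notMem_arc {z : Circle}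
    (hz : ∀ i, z ∉ R.arc i) : R.bowenSeriesMap z = z :=
  dif_neg (not_exists.2 hz)

theorem MarkedIdealPolygon.semiconj_bowenSeriesMap_translate
    (hR : Pairwise (Function.onFun Disjoint R.arc)) {γ : Circle ≃ₜ Circle}
    (hγ : ∀ a b z, γ z ∈ ccwArc (γ a) (γ b) ↔ z ∈ ccwArc a b) :
    Function.Semiconj γ R.bowenSeriesMap (R.translate γ).bowenSeriesMap := by
  have harc : ∀ i, γ ⁻¹' (R.translate γ).arc i = R.arc i := fun i => Set.ext fun _ => hγ _ _ _
  have hRγ : Pairwise (Function.onFun Disjoint (R.translate γ).arc) := fun i j hij =>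
    (Set.disjoint_preimage_iff γ.surjective).1 (by simpa only [harc] using hR hij)
  intro z
  by_cases hz : ∃ i, z ∈ R.arc i
  · obtain ⟨i, hi⟩ := hz
    have hγi : γ z ∈ (R.translate γ).arc i := (hγ _ _ _).2 hi
    rw [bowenSeriesMap_of_mem_arc hR hi, bowenSeriesMap_of_mem_arc hRγ hγi]
    exact congrArg (fun w => γ (R.pairing i w)) (γ.symm_apply_apply z).symm
  · rw [not_exists] at hz
    rw [bowenSeriesMap_of_forall_notMem_arc hz,
      bowenSeriesMap_of_forall_notMem_arc fun i hi => hz i ((hγ _ _ _).1 hi)]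

end IdealPolygon

theorem mem_ccwArc_exp_iff {a b : ℝ} (hab : a < b) (hba : b < a + 2 * π) {z : Circle} :
    z ∈ ccwArc (Circle.exp a) (Circle.exp b) ↔ ∃ x ∈ Set.Ico a b, z = Circle.exp x := by
  constructor
  · rintro ⟨s, t, hs, hst, ht, hb, rfl⟩
    rw [← Circle.exp_add] at hb ⊢
    have hbt : b = t + a := Circle.exp_injOn_Ico (by linarith : a + 2 * π - a ≤ 2 * π)
      ⟨hab.le, hba⟩ ⟨by linarith, by linarith⟩ hb
    exact ⟨s + a, ⟨by linarith, by linarith⟩, rfl⟩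
  · rintro ⟨x, ⟨hax, hxb⟩, rfl⟩
    refine ⟨x - a, b - a, by linarith, by linarith, by linarith, ?_, ?_⟩ <;>
      rw [← Circle.exp_add, sub_add_cancel]

theorem exists_coe_finRotate {n : ℕ} (k : Fin n) :
    ∃ m : ℤ, ((finRotate n k : ℕ) : ℤ) = (k : ℕ) + 1 + n * m := by
  cases n with
  | zero => exact k.elim0
  | succ n =>
    rw [coe_finRotate]
    split_ifs with hk
    · exact ⟨-1, by rw [hk, Fin.val_last]; push_cast; ring⟩
    · exact ⟨0, by push_cast; ring⟩

theorem exists_eq_fin_add_mul {n : ℕ} (hn : 0 < n) (k : ℤ) :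
    ∃ (i : Fin n) (m : ℤ), k = (i : ℕ) + n * m := by
  have hnonneg : 0 ≤ k % n := Int.emod_nonneg k (by omega)
  have hlt : k % n < n := Int.emod_lt_of_pos k (by omega)
  refine ⟨⟨(k % n).toNat, by omega⟩, k / n, ?_⟩
  rw [Int.toNat_of_nonneg hnonneg, Int.emod_add_mul_ediv]

section BowenSeries

variable {d : ℕ}

theorem vertex_preferredDomain (hd : 2 ≤ d) (k : Fin (2 * d)) :
    (preferredDomain hd).vertex k = Circle.exp (sideMid d (k : ℕ) - sideHalfAngle d) := by
  change Circle.exp (π * (k : ℕ) / d) = _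
  rw [sideMid, sideHalfAngle, Int.cast_natCast]
  congr 1
  field_simp
  ring

theorem vertex_finRotate_preferredDomain (hd : 2 ≤ d) (k : Fin (2 * d)) :
    (preferredDomain hd).vertex (finRotate _ k) =
      Circle.exp (sideMid d (k : ℕ) + sideHalfAngle d) := by
  obtain ⟨m, hm⟩ := exists_coe_finRotate k
  rw [vertex_preferredDomain, hm, sideMid_add_mul hd, sideMid, sideMid]
  refine Circle.exp_eq_exp.2 ⟨m, ?_⟩
  push_cast
  ring

theorem mem_arc_preferredDomain_iff (hd : 2 ≤ d) {k : Fin (2 * d)} {z : Circle} :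
    z ∈ (preferredDomain hd).arc k ↔
      ∃ s ∈ Set.Ico (-sideHalfAngle d) (sideHalfAngle d),
        z = Circle.exp (sideMid d (k : ℕ) + s) := by
  have hpos := sideHalfAngle_pos hd
  have hlt := sideHalfAngle_lt_pi_div_two hd
  rw [MarkedIdealPolygon.arc, vertex_preferredDomain, vertex_finRotate_preferredDomain,
    mem_ccwArc_exp_iff (by linarith) (by linarith [pi_pos])]
  constructor
  · rintro ⟨x, ⟨hx₁, hx₂⟩, rfl⟩
    exact ⟨x - sideMid d (k : ℕ), ⟨by linarith, by linarith⟩, by rw [add_sub_cancel]⟩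
  · rintro ⟨s, ⟨hs₁, hs₂⟩, rfl⟩
    exact ⟨_, ⟨by linarith, by linarith⟩, rfl⟩

theorem pairwise_disjoint_arc_preferredDomain (hd : 2 ≤ d) :
    Pairwise (Function.onFun Disjoint (preferredDomain hd).arc) := by
  refine fun i j hij => Set.disjoint_left.2 fun z hi hj => hij ?_
  obtain ⟨s, hs, rfl⟩ := (mem_arc_preferredDomain_iff hd).1 hi
  obtain ⟨t, ht, hst⟩ := (mem_arc_preferredDomain_iff hd).1 hj
  obtain ⟨m, hm⟩ := Circle.exp_eq_exp.1 hst
  have hindex_i : sideIndex d (sideMid d (i : ℕ) + s) = (i : ℕ) :=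
    (sideIndex_eq_iff hd).2 (by rwa [add_sub_cancel_left])
  have hindex_j : sideIndex d (sideMid d (i : ℕ) + s) = (j : ℕ) + (2 * d : ℕ) * m := by
    rwa [sideIndex_eq_iff hd, hm, sideMid_add_mul hd, add_right_comm, add_sub_cancel_left]
  have hmod : (i : ℕ) ≡ j [MOD 2 * d] := Int.natCast_modEq_iff.1 <| by
    rw [← hindex_i, hindex_j]
    exact Int.modEq_add_fac_self
  exact Fin.ext (hmod.eq_of_lt_of_lt i.2 j.2)

theorem bowenSeriesMap_eq_pairing (hd : 2 ≤ d) {k : Fin (2 * d)} {z : Circle}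
    (hz : z ∈ (preferredDomain hd).arc k) :
    (preferredDomain hd).bowenSeriesMap z = (preferredDomain hd).pairing k z :=
  MarkedIdealPolygon.bowenSeriesMap_of_mem_arc (pairwise_disjoint_arc_preferredDomain hd) hz

theorem pairing_mem_arc_rev (hd : 2 ≤ d) {k : Fin (2 * d)} {z : Circle}
    (hz : z ∉ (preferredDomain hd).arc k) :
    (preferredDomain hd).pairing k z ∈ (preferredDomain hd).arc k.rev := by
  obtain ⟨x, rfl⟩ := Circle.exp_surjective z
  obtain ⟨y, ⟨hy₁, hy₂⟩, hxy⟩ := Circle.periodic_exp.exists_mem_Ico two_pi_pos x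
    (sideMid d (k : ℕ) - sideHalfAngle d)
  obtain ⟨s, rfl⟩ : ∃ s, y = sideMid d (k : ℕ) + s := ⟨_, (add_sub_cancel _ _).symm⟩
  rw [hxy] at hz ⊢
  have hs₁ : sideHalfAngle d ≤ s := by
    by_contra! hs
    exact hz ((mem_arc_preferredDomain_iff hd).2 ⟨s, ⟨by linarith, hs⟩, rfl⟩)
  have hs₂ : s < -sideHalfAngle d + 2 * π := by linarith
  have hlower := (strictMono_sideLift hd).monotone hs₁
  have hupper := strictMono_sideLift hd hs₂
  rw [sideLift_sideHalfAngle hd] at hlower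
  rw [sideLift_add_two_pi, sideLift_neg_sideHalfAngle hd] at hupper
  rw [pairing_exp, mem_arc_preferredDomain_iff, sideMid_rev hd]
  refine ⟨sideLift d s - π, ⟨by linarith, by linarith⟩, ?_⟩
  ring_nf

theorem bowenSeriesMap_eq_pairing_or_comp_pairing_eq (hd : 2 ≤ d) (k : Fin (2 * d)) (z : Circle) :
    (preferredDomain hd).bowenSeriesMap z = (preferredDomain hd).pairing k z ∨
      (preferredDomain hd).bowenSeriesMap ((preferredDomain hd).pairing k z) = z := by
  by_cases hz : z ∈ (preferredDomain hd).arc k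
  · exact Or.inl (bowenSeriesMap_eq_pairing hd hz)
  · rw [bowenSeriesMap_eq_pairing hd (pairing_mem_arc_rev hd hz), pairing_rev]
    exact Or.inr (((preferredDomain hd).pairing k).symm_apply_apply z)

/-- The lift to the real line, in the angle coordinate, of the Bowen-Series map of the preferred
domain. Its value at `sideMid d k` is chosen to be `(2 * d - 1) * sideMid d k`, which makes it
continuous at the vertices. -/
noncomputable def bowenSeriesLift (d : ℕ) (x : ℝ) : ℝ :=
  (2 * d - 1) * sideMid d (sideIndex d x) + sideLift d (x - sideMid d (sideIndex d x))

theorem bowenSeriesLift_add_two_pi (hd : 2 ≤ d) (x : ℝ) :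
    bowenSeriesLift d (x + 2 * π) = bowenSeriesLift d x + (2 * d - 1) * (2 * π) := by
  rw [bowenSeriesLift, bowenSeriesLift, sideIndex_add_two_pi hd, sideMid_add_mul hd, Int.cast_one,
    one_mul, add_sub_add_right_eq_sub]
  ring

theorem continuous_bowenSeriesLift (hd : 2 ≤ d) : Continuous (bowenSeriesLift d) := by
  set α := sideHalfAngle d with hα
  have hα₀ : 2 * α ≠ 0 := by linarith [sideHalfAngle_pos hd]
  let h : ℝ → ℝ := fun t => sideLift d (2 * α * t - α) - (2 * d - 1) * (2 * α * t - α)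
  have hfract : bowenSeriesLift d = fun x => (2 * d - 1) * x + (h ∘ Int.fract) (x / (2 * α)) := by
    funext x
    have hx : 2 * α * Int.fract (x / (2 * α)) - α = x - sideMid d (sideIndex d x) := by
      rw [Int.fract, sideMid, sideIndex, ← hα, mul_sub, mul_div_cancel₀ _ hα₀]
      ring
    simp only [h, Function.comp_apply, hx, bowenSeriesLift]
    ring
  have hcont : Continuous h := ((continuous_sideLift hd).comp (by fun_prop)).sub (by fun_prop)
  have hends : h 0 = h 1 := by
    have hleft : 2 * α * 0 - α = -α := by ring
    have hright : 2 * α * 1 - α = α := by ring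
    dsimp only [h]
    rw [hleft, hright, sideLift_sideHalfAngle hd, sideLift_neg_sideHalfAngle hd]
    linear_combination 2 * two_mul_mul_sideHalfAngle hd
  rw [hfract]
  exact (continuous_const.mul continuous_id).add
    ((hcont.continuousOn.comp_fract'' hends).comp (continuous_id.div_const _))

theorem strictMono_bowenSeriesLift_sub_id (hd : 2 ≤ d) :
    StrictMono fun x => bowenSeriesLift d x - x := by
  have hpos := sideHalfAngle_pos hd
  have hmono := strictMonoOn_sideLift_sub_id hd
  intro x y hxy
  obtain ⟨hx₁, hx₂⟩ := (sideIndex_eq_iff (x := x) hd).1 rfl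
  obtain ⟨hy₁, hy₂⟩ := (sideIndex_eq_iff (x := y) hd).1 rfl
  have hindex : sideIndex d x ≤ sideIndex d y :=
    Int.floor_mono (div_le_div_of_nonneg_right hxy.le (by linarith))
  simp only [bowenSeriesLift]
  rcases hindex.eq_or_lt with heq | hlt
  · rw [heq] at hx₁ hx₂ ⊢
    have hsame := hmono ⟨hx₁, hx₂.le⟩ ⟨hy₁, hy₂.le⟩ (sub_lt_sub_right hxy _)
    dsimp only at hsame
    linarith
  · have hright := hmono ⟨hx₁, hx₂.le⟩ (Set.right_mem_Icc.2 (by linarith)) hx₂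
    have hleft := hmono.monotoneOn (Set.left_mem_Icc.2 (by linarith)) ⟨hy₁, hy₂.le⟩ hy₁
    have hgap : 0 ≤ (2 * d - 2) * (2 * sideHalfAngle d) * (sideIndex d y - sideIndex d x - 1) := by
      have hd' : (2 : ℝ) ≤ d := by exact_mod_cast hd
      have hlt' : (sideIndex d x : ℝ) + 1 ≤ sideIndex d y := by exact_mod_cast hlt
      exact mul_nonneg (mul_nonneg (by linarith) (by linarith)) (by linarith)
    dsimp only at hright hleft
    rw [sideLift_sideHalfAngle hd] at hright
    rw [sideLift_neg_sideHalfAngle hd] at hleft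
    simp only [sideMid] at hright hleft ⊢
    linarith [two_mul_mul_sideHalfAngle hd]

theorem bowenSeriesMap_exp (hd : 2 ≤ d) (x : ℝ) :
    (preferredDomain hd).bowenSeriesMap (Circle.exp x) = Circle.exp (bowenSeriesLift d x) := by
  obtain ⟨k, m, hk⟩ := exists_eq_fin_add_mul (n := 2 * d) (by omega) (sideIndex d x)
  have hmid : sideMid d (sideIndex d x) = sideMid d (k : ℕ) + m * (2 * π) := by
    rw [hk, sideMid_add_mul hd]
  set s := x - sideMid d (sideIndex d x) with hs
  have hx : Circle.exp x = Circle.exp (sideMid d (k : ℕ) + s) :=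
    Circle.exp_eq_exp.2 ⟨m, by rw [hs, hmid]; ring⟩
  rw [hx, bowenSeriesMap_eq_pairing hd
    ((mem_arc_preferredDomain_iff hd).2 ⟨s, (sideIndex_eq_iff hd).1 rfl, rfl⟩), pairing_exp,
    bowenSeriesLift, ← hs]
  refine Circle.exp_eq_exp.2 ⟨m - sideIndex d x, ?_⟩
  have hmid' : 2 * d * sideMid d (sideIndex d x) = π * (2 * sideIndex d x + 1) := by
    rw [sideMid, ← mul_assoc, two_mul_mul_sideHalfAngle hd]
  push_cast
  linear_combination hmid - hmid'

theorem exists_conjugacy_bowenSeriesMap (hd : 2 ≤ d) :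
    ∃ Φ : UnitAddCircle ≃ₜ Circle,
      Function.Semiconj Φ (circleMul (2 * d - 1)) (preferredDomain hd).bowenSeriesMap := by
  have hπ := two_pi_pos
  have hN : ((2 * d - 1 : ℕ) : ℝ) = 2 * d - 1 := by
    rw [Nat.cast_sub (by omega)]
    push_cast
    rfl
  refine exists_conjugacy_circleMul (f := fun x => bowenSeriesLift d (2 * π * x) / (2 * π))
    (by omega) ?_ (fun x => ?_) (fun x y hxy => ?_) (fun x => ?_)
  · exact ((continuous_bowenSeriesLift hd).comp (continuous_const.mul continuous_id)).div_const _
  · rw [mul_add, mul_one, bowenSeriesLift_add_two_pi hd, add_div, mul_div_cancel_right₀ _ hπ.ne',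
      hN]
  · have := strictMono_bowenSeriesLift_sub_id hd (mul_lt_mul_of_pos_left hxy hπ)
    dsimp only at this
    rw [← sub_div, lt_div_iff₀ hπ]
    linarith
  · rw [bowenSeriesMap_exp, mul_div_cancel₀ _ hπ.ne']

end BowenSeries

theorem mem_ccwArc_of_lift {γ : Circle → Circle} {G : ℝ → ℝ} (hG : StrictMono G)
    (hper : ∀ x, G (x + 2 * π) = G x + 2 * π) (hγ : ∀ x, γ (Circle.exp x) = Circle.exp (G x))
    {a b z : Circle} (hz : z ∈ ccwArc a b) : γ z ∈ ccwArc (γ a) (γ b) := by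
  obtain ⟨s, t, hs, hst, ht, rfl, rfl⟩ := hz
  obtain ⟨u, rfl⟩ := Circle.exp_surjective a
  have hturn : G (t + u) < G u + 2 * π := (hG (by linarith)).trans_eq (hper u)
  refine ⟨G (s + u) - G u, G (t + u) - G u, ?_, ?_, ?_, ?_, ?_⟩
  · exact sub_nonneg.2 (hG.monotone (by linarith))
  · exact sub_lt_sub_right (hG (by linarith)) _
  · linarith
  · rw [← Circle.exp_add, hγ, hγ, ← Circle.exp_add, sub_add_cancel]
  · rw [← Circle.exp_add, hγ, hγ, ← Circle.exp_add, sub_add_cancel]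

theorem isometry_inv_circle : Isometry (Inv.inv : Circle → Circle) :=
  Isometry.of_dist_eq fun x y => by
    change dist ((x⁻¹ : Circle) : ℂ) ((y⁻¹ : Circle) : ℂ) = dist (x : ℂ) (y : ℂ)
    rw [Circle.coe_inv_eq_conj, Circle.coe_inv_eq_conj, dist_eq_norm, ← map_sub, Complex.norm_conj,
      dist_eq_norm]

theorem exists_lipschitzWith_hypReflection {c : ℂ} {r : ℝ} (hr : r ≠ 0) (h : ‖c‖ ^ 2 = 1 + r ^ 2) :
    ∃ K, LipschitzWith K (hypReflection c r hr h) := by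
  obtain ⟨m, hm₀, hm⟩ : ∃ m > 0, ‖c‖ = m + 1 := by
    refine ⟨‖c‖ - 1, ?_, (sub_add_cancel _ _).symm⟩
    have : 0 < r ^ 2 := by positivity
    nlinarith [norm_nonneg c]
  have hdist : ∀ z : Circle, m ≤ dist (z : ℂ) c := fun z => by
    have := norm_sub_norm_le c (z : ℂ)
    rw [Circle.norm_coe, hm] at this
    rw [dist_comm, dist_eq_norm]
    linarith
  have hne : ∀ z : Circle, (z : ℂ) ≠ c := fun z => dist_pos.1 (hm₀.trans_le (hdist z))
  refine ⟨(r ^ 2 / (m * m)).toNNReal, LipschitzWith.of_dist_le_mul fun x y => ?_⟩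
  rw [Real.coe_toNNReal _ (by positivity)]
  change dist (EuclideanGeometry.inversion c r (x : ℂ)) (EuclideanGeometry.inversion c r (y : ℂ)) ≤
    _ * dist (x : ℂ) (y : ℂ)
  rw [EuclideanGeometry.dist_inversion_inversion (hne x) (hne y)]
  gcongr
  · exact hdist x
  · exact hdist y

section HausdorffDimension

variable {X Y : Type*} [EMetricSpace X] [MeasurableSpace X] [BorelSpace X]
  [EMetricSpace Y] [MeasurableSpace Y] [BorelSpace Y]

theorem measureHausdorffDim_map_le (γ : X ≃ₜ Y) {K : NNReal} (hK : LipschitzWith K γ)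
    (μ : Measure X) : measureHausdorffDim (μ.map γ) ≤ measureHausdorffDim μ := by
  refine le_iInf fun S => le_iInf fun hS => le_iInf fun hμS => ?_
  have himage : MeasurableSet (γ '' S) := γ.measurableEmbedding.measurableSet_image.2 hS
  have hfull : μ.map γ (γ '' S) = 1 := by
    rw [γ.measurableEmbedding.map_apply, Set.preimage_image_eq _ γ.injective, hμS]
  refine le_trans ?_ (hK.dimH_image_le S)
  exact iInf₂_le_of_le (γ '' S) himage (iInf_le _ hfull)

theorem measureHausdorffDim_map_eq (γ : X ≃ₜ Y) {K L : NNReal} (hK : LipschitzWith K γ)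
    (hL : LipschitzWith L γ.symm) (μ : Measure X) :
    measureHausdorffDim (μ.map γ) = measureHausdorffDim μ := by
  refine le_antisymm (measureHausdorffDim_map_le γ hK μ) ?_
  have hback : (μ.map γ).map γ.symm = μ := by
    rw [Measure.map_map γ.symm.measurable γ.measurable, γ.symm_comp_self, Measure.map_id]
  simpa only [hback] using measureHausdorffDim_map_le γ.symm hL (μ.map γ)

end HausdorffDimension

section QuasiInvariance

variable {X Y : Type*} [TopologicalSpace X] [MeasurableSpace X] [BorelSpace X]
  [TopologicalSpace Y] [MeasurableSpace Y] [BorelSpace Y]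

-- Split a null set `E` according to the alternative: where `p` agrees with `A`, the preimage
-- `p ⁻¹' E` lies in `A ⁻¹' E`; where `A` undoes `p`, it lies in `A '' E`.
theorem map_absolutelyContinuous_of_eq_or_comp_eq [T2Space X] {ν : Measure X} {A : X → X}
    (hA : Continuous A) (hinv : MeasurePreserving A ν ν)
    (hnull : ∀ E, ν E = 0 → ν (A ⁻¹' (A '' E)) = 0) (p : X ≃ₜ X)
    (hp : ∀ x, A x = p x ∨ A (p x) = x) : ν.map p ≪ ν := by
  refine Measure.AbsolutelyContinuous.mk fun E hE hνE => ?_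
  rw [Measure.map_apply p.measurable hE]
  set S := p ⁻¹' (E ∩ {y | A y = p.symm y})
  have hS_meas : MeasurableSet S :=
    p.measurable (hE.inter (isClosed_eq hA p.symm.continuous).measurableSet)
  have hS_subset : S ⊆ A '' E := fun x hx => ⟨p x, hx.1, hx.2.trans (p.symm_apply_apply x)⟩
  have hνS : ν S = 0 := by
    rw [← hinv.measure_preimage hS_meas.nullMeasurableSet]
    exact measure_mono_null (Set.preimage_mono hS_subset) (hnull E hνE)
  have hνAE : ν (A ⁻¹' E) = 0 := by rw [hinv.measure_preimage hE.nullMeasurableSet, hνE]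
  refine measure_mono_null (fun x hx => ?_) (measure_union_null hνAE hνS)
  rcases hp x with h | h
  · exact Or.inl (Set.mem_preimage.2 (h ▸ hx))
  · exact Or.inr ⟨hx, h.trans (p.symm_apply_apply x).symm⟩

theorem map_preimage_image_eq_zero_of_semiconj {S : X → X} {T : Y → Y} (φ : X ≃ₜ Y)
    (hφ : Function.Semiconj φ S T) {μ : Measure X}
    (hnull : ∀ E, μ E = 0 → μ (S ⁻¹' (S '' E)) = 0) {E : Set Y} (hE : μ.map φ E = 0) :
    μ.map φ (T ⁻¹' (T '' E)) = 0 := by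
  rw [φ.measurableEmbedding.map_apply] at hE ⊢
  refine measure_mono_null ?_ (hnull _ hE)
  rintro x ⟨y, hy, hyx⟩
  refine ⟨φ.symm y, Set.mem_preimage.2 (by rwa [φ.apply_symm_apply]), φ.injective ?_⟩
  rw [hφ.eq, φ.apply_symm_apply, hyx, hφ.eq]

end QuasiInvariance

section GroupAction

variable {d : ℕ}

theorem mem_ccwArc_of_mem (hd : 2 ≤ d) {γ : Circle ≃ₜ Circle} (hγ : γ ∈ puncturedSphereGroup hd) :
    ∀ {a b z}, z ∈ ccwArc a b → γ z ∈ ccwArc (γ a) (γ b) := by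
  refine puncturedSphereGroup_induction hd
    (p := fun γ => ∀ {a b z}, z ∈ ccwArc a b → γ z ∈ ccwArc (γ a) (γ b))
    (fun k a b z => ?_) id (fun γ₁ γ₂ h₁ h₂ a b z hz => h₁ (h₂ hz)) hγ
  refine mem_ccwArc_of_lift
    (G := fun x => π - sideMid d (k : ℕ) + sideLift d (x - sideMid d (k : ℕ)))
    (fun x y hxy => ?_) (fun x => ?_) (fun x => ?_)
  · exact add_lt_add_right (strictMono_sideLift hd (sub_lt_sub_right hxy _)) _
  · rw [add_sub_right_comm, sideLift_add_two_pi, add_assoc]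
  · rw [← pairing_exp hd, add_sub_cancel]

theorem mem_ccwArc_iff_of_mem (hd : 2 ≤ d) {γ : Circle ≃ₜ Circle}
    (hγ : γ ∈ puncturedSphereGroup hd) (a b z : Circle) :
    γ z ∈ ccwArc (γ a) (γ b) ↔ z ∈ ccwArc a b := by
  refine ⟨fun h => ?_, mem_ccwArc_of_mem hd hγ⟩
  simpa only [Homeomorph.inv_apply, γ.symm_apply_apply] using mem_ccwArc_of_mem hd (inv_mem hγ) h

theorem exists_lipschitzWith_of_mem (hd : 2 ≤ d) {γ : Circle ≃ₜ Circle}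
    (hγ : γ ∈ puncturedSphereGroup hd) : ∃ K, LipschitzWith K γ := by
  refine puncturedSphereGroup_induction hd (p := fun γ => ∃ K, LipschitzWith K γ)
    (fun k => ?_) ⟨1, LipschitzWith.id⟩ ?_ hγ
  · obtain ⟨j, rfl | rfl⟩ := exists_eq_castLE_or_eq_rev_castLE k <;>
      obtain ⟨K, hK⟩ := exists_lipschitzWith_hypReflection (sideRadius_ne_zero hd)
        (norm_sideCenter_sq hd j)
    · rw [pairing_castLE]
      exact ⟨_, isometry_inv_circle.lipschitz.comp hK⟩
    · rw [pairing_rev_castLE]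
      exact ⟨_, hK.comp isometry_inv_circle.lipschitz⟩
  · rintro γ₁ γ₂ ⟨K₁, h₁⟩ ⟨K₂, h₂⟩
    exact ⟨_, h₁.comp h₂⟩

theorem measureHausdorffDim_map_of_mem (hd : 2 ≤ d) {γ : Circle ≃ₜ Circle}
    (hγ : γ ∈ puncturedSphereGroup hd) (μ : Measure Circle) :
    measureHausdorffDim (μ.map γ) = measureHausdorffDim μ := by
  obtain ⟨K, hK⟩ := exists_lipschitzWith_of_mem hd hγ
  obtain ⟨L, hL⟩ := exists_lipschitzWith_of_mem hd (inv_mem hγ)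
  exact measureHausdorffDim_map_eq γ hK hL μ

theorem exists_isMME_bowenSeriesMap (hd : 2 ≤ d) :
    ∃ ν : Measure Circle, (∀ μ, IsMME (preferredDomain hd).bowenSeriesMap μ ↔ μ = ν) ∧
      ∀ k, ν.map ((preferredDomain hd).pairing k) ≪ ν := by
  have : NeZero (2 * d - 1) := ⟨by omega⟩
  obtain ⟨Φ, hΦ⟩ := exists_conjugacy_bowenSeriesMap hd
  have hMME := isMME_iff_eq_map_homeomorph Φ hΦ
    fun μ => isMME_circleMul_iff (μ := μ) (by omega : 1 < 2 * d - 1)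
  have hcont : Continuous (preferredDomain hd).bowenSeriesMap := by
    rw [← Φ.comp_continuous_iff', ← hΦ.comp_eq]
    exact Φ.continuous.comp (continuous_nsmul _)
  exact ⟨_, hMME, fun k => map_absolutelyContinuous_of_eq_or_comp_eq hcont
    ((hMME _).2 rfl).measurePreserving
    (fun E => map_preimage_image_eq_zero_of_semiconj Φ hΦ
      fun E => volume_preimage_image_circleMul) _
    (bowenSeriesMap_eq_pairing_or_comp_pairing_eq hd k)⟩

theorem map_absolutelyContinuous_of_mem (hd : 2 ≤ d) {ν : Measure Circle}
    (hν : ∀ k, ν.map ((preferredDomain hd).pairing k) ≪ ν) {γ : Circle ≃ₜ Circle}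
    (hγ : γ ∈ puncturedSphereGroup hd) : ν.map γ ≪ ν := by
  refine puncturedSphereGroup_induction hd (p := fun γ => ν.map γ ≪ ν) hν ?_
    (fun γ₁ γ₂ h₁ h₂ => ?_) hγ
  · exact (Measure.map_id (μ := ν)).absolutelyContinuous
  · have hmul : ν.map (γ₁ * γ₂ : Circle ≃ₜ Circle) = (ν.map γ₂).map γ₁ :=
      (Measure.map_map γ₁.measurable γ₂.measurable).symm
    rw [hmul]
    exact (h₂.map γ₁.measurable).trans h₁

theorem absolutelyContinuous_map_of_mem (hd : 2 ≤ d) {ν : Measure Circle}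
    (hν : ∀ k, ν.map ((preferredDomain hd).pairing k) ≪ ν) {γ : Circle ≃ₜ Circle}
    (hγ : γ ∈ puncturedSphereGroup hd) : ν ≪ ν.map γ := by
  have hinv : ν.map γ.symm ≪ ν := map_absolutelyContinuous_of_mem hd hν (inv_mem hγ)
  have hback : (ν.map γ.symm).map γ = ν := by
    rw [Measure.map_map γ.measurable γ.symm.measurable, γ.self_comp_symm, Measure.map_id]
  simpa only [hback] using hinv.map γ.measurable

theorem isMME_translate_iff (hd : 2 ≤ d) {ν : Measure Circle}
    (hν : ∀ μ, IsMME (preferredDomain hd).bowenSeriesMap μ ↔ μ = ν) {γ : Circle ≃ₜ Circle}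
    (hγ : γ ∈ puncturedSphereGroup hd) (μ : Measure Circle) :
    IsMME ((preferredDomain hd).translate γ).bowenSeriesMap μ ↔ μ = ν.map γ :=
  isMME_iff_eq_map_homeomorph γ (MarkedIdealPolygon.semiconj_bowenSeriesMap_translate
    (pairwise_disjoint_arc_preferredDomain hd) (mem_ccwArc_iff_of_mem hd hγ)) hν μ

end GroupAction

theorem mainTheorem5 {d : ℕ} (hd : 2 ≤ d) :
    -- the Bowen-Series map has a unique measure of maximal entropy
    (∃! ν : Measure Circle, IsMME (preferredDomain hd).bowenSeriesMap ν) ∧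
    -- its measure class is invariant under the group
    (∀ ν : Measure Circle, IsMME (preferredDomain hd).bowenSeriesMap ν →
      ∀ γ ∈ puncturedSphereGroup hd, ν ≪ ν.map γ ∧ ν.map γ ≪ ν) ∧
    -- the Bowen-Series map of each translated fundamental domain has a unique MME as well
    (∀ γ ∈ puncturedSphereGroup hd,
      ∃! ν : Measure Circle, IsMME ((preferredDomain hd).translate γ).bowenSeriesMap ν) ∧
    -- the measures of maximal entropy for all translates are mutually absolutely continuous and
    -- have the same Hausdorff dimension
    (∀ γ₁ ∈ puncturedSphereGroup hd, ∀ γ₂ ∈ puncturedSphereGroup hd, ∀ ν₁ ν₂ : Measure Circle,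
      IsMME ((preferredDomain hd).translate γ₁).bowenSeriesMap ν₁ →
      IsMME ((preferredDomain hd).translate γ₂).bowenSeriesMap ν₂ →
      (ν₁ ≪ ν₂ ∧ ν₂ ≪ ν₁) ∧ measureHausdorffDim ν₁ = measureHausdorffDim ν₂) := by
  obtain ⟨ν, hν, hpairing⟩ := exists_isMME_bowenSeriesMap hd
  refine ⟨⟨ν, (hν ν).2 rfl, fun μ => (hν μ).1⟩, ?_, ?_, ?_⟩
  · intro μ hμ γ hγ
    obtain rfl := (hν μ).1 hμ
    exact ⟨absolutelyContinuous_map_of_mem hd hpairing hγ,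
      map_absolutelyContinuous_of_mem hd hpairing hγ⟩
  · intro γ hγ
    exact ⟨ν.map γ, (isMME_translate_iff hd hν hγ _).2 rfl,
      fun μ => (isMME_translate_iff hd hν hγ μ).1⟩
  · intro γ₁ hγ₁ γ₂ hγ₂ ν₁ ν₂ hν₁ hν₂
    obtain rfl := (isMME_translate_iff hd hν hγ₁ ν₁).1 hν₁
    obtain rfl := (isMME_translate_iff hd hν hγ₂ ν₂).1 hν₂
    have hmap : ∀ {γ γ'}, γ ∈ puncturedSphereGroup hd → γ' ∈ puncturedSphereGroup hd →
        ν.map γ ≪ ν.map γ' := fun hγ hγ' =>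
      (map_absolutelyContinuous_of_mem hd hpairing hγ).trans
        (absolutelyContinuous_map_of_mem hd hpairing hγ')
    refine ⟨⟨hmap hγ₁ hγ₂, hmap hγ₂ hγ₁⟩, ?_⟩
    rw [measureHausdorffDim_map_of_mem hd hγ₁, measureHausdorffDim_map_of_mem hd hγ₂]
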